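/- **Setting.** For a finite group $K$ let $\overline K$ be its class hypergroup, whose elements are the conjugacy classes $C$, with weight $w_C=|C|$ and structure constants $n_{C,D}^E=\Pr[gh\in E]$ for independent uniform $g\in C,\ h\in D$. A normal subgroup $N\trianglelefteq K$ gives the subhypergroup $\overline N_K$ of the classes contained in $N$. The coset $C\,\overline N_K$ consists of all $E$ with $n_{C,D}^E\ne0$ for some $D\in\overline N_K$. A function $f$ on $\overline K$ *hides* $\overline N_K$ if $f(C)=f(D)\iff C\overline N_K=D\overline N_K$. For an irreducible character $\chi_\mu$ of $K$ of dimension $d_\mu$ put $\mathcal X_\mu=\chi_\mu/d_\mu$ and $w_\mu=d_\mu^2$; $\mathcal X_1$ is the trivial character. The QFT over $\overline K$ is $\mathcal F_{\overline K}|C\rangle=\sum_\mu\sqrt{w_\mu w_C/|K|}\,\mathcal X_\mu(C)|\mathcal X_\mu\rangle$. *AKR Fourier sampling* with oracle $f$ prepares $|\mathcal X_1\rangle$, applies $\mathcal F_{\overline K}^{-1}$, evaluates $f$ into a second register, applies $\mathcal F_{\overline K}$ to the first register, and measures $\mu$. Algorithms are quantum circuits of one- and two-qubit unitary gates and oracle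 queries $|x\rangle|y\rangle\mapsto|x\rangle|y\oplus F(x)\rangle$, started in $|0\cdots0\rangle$ with a final measurement. The *cost* is the number of qubits (including ancillas) plus the number of gates and queries. Irreducible characters of normal subgroups of $G$ (the trivial one by the zero string), conjugacy classes, and elements are labelled injectively by bit strings. Normal subgroups of $G$ are addressed by sequences of $T$ labels: starting with $K_0=G$, the $t$-th label is that of an irreducible character $\mu_t$ of $K_{t-1}$, and $K_t$ is the largest normal subgroup of $G$ contained in $\ker\mu_t$; the sequence is an address of $K_T$. The QFTs (and the class computations in (3)) over all $K$ are performed by one circuit that acts coherently on a register holding an address of $K$, and that is only required to be correct for addresses of normal subgroups $K$ of $G$ with $N\le K$. **Theorem.** Let $G$ be a finite group and $N\trianglelefteq G$. 1. If $f$ hides $\overline N_G$, then every $\mathcal X_\mu$ that AKR Fourier sampling over $\overline G$ yields with positive probability satisfies $N\le\ker\mu$; and if $N\ne G$, the trivial irrep is sampled with probability at most $1/2$. 2. (CC-HSHP is easy, II.) For every polynomial $p$ there is a polynomial $q$, depending only on $p$, such that the following holds for all $G$ and all $k\ge 0$, with $n=\lfloor\log_2|G|\rfloor+k$ and $T=4n$.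 Let a circuit of cost at most $p(n)$ be given. *Recursive AKR sampling* is the following circuit: in each of $T$ rounds it performs one run of AKR over the currently addressed $K$ (inverse QFT, oracle query, QFT) and stores the sampled label in the next slot of the address register; at the end it measures the address. It has cost at most $q(n)$ if the oracle labels have at most $p(n)$ bits. It depends only on the given circuit and on the register sizes, not on $N$ or the oracle. For every $N\trianglelefteq G$ such that the given circuit computes the QFT over $\overline K$ for each normal subgroup $K$ of $G$ with $N\le K\le G$, and for all oracles $\overline f_K$ on $\overline K$ that hide $\overline N_K$ for each such $K$ (queried with an address of $K$ and a class of $K$), it outputs an address of $N$ with probability at least $1-2^{-k}$. 3. (HNSP is easy, II.) Likewise, for every polynomial $p$ there is a polynomial $q$, depending only on $p$, such that the following holds for all $G$ and $k$, with $n$ and $T$ as above. Let $f:G\to H$ be a homomorphism given as an oracle with $f(x)=f(x')\iff x'\in xN$. Suppose that circuits of cost at most $p(n)$ compute, for each normal subgroup $K$ of $G$ with $N\le K\le G$, the group QFT $|g\rangle\mapsto\sum_{\mu,i,j}\sqrt{d_\mu/|K|}\,\mu(g)_{ij}|\mu,i,j\rangle$ over $K$ (for some unitary matrix irreps $\mu$),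 and the label of the conjugacy class in $H_K=f(K)$ of a given element of $H_K$. Then the same recursion, with one run of sampling using the oracle $x\mapsto C_{f(x)}$ per round (two queries to $f$), is a circuit of cost at most $q(n)$, depending only on the given circuits and register sizes, that outputs an address of $N$ with probability at least $1-2^{-k}$. -/

import Mathlib

open scoped ComplexConjugate

noncomputable section

namespace HSHP

/-! ### The class hypergroup of a finite group -/

section ClassHypergroup

variable {G : Type*} [Group G]

/-- The structure constant `n_{C,D}^E` of the class hypergroup: the probability that a product of
a uniformly random element of `C` and a uniformly random element of `D` lies in `E`. -/
def structConst (C D E : ConjClasses G) : ℝ :=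
  (Nat.card {p : G × G // p.1 ∈ C.carrier ∧ p.2 ∈ D.carrier ∧ p.1 * p.2 ∈ E.carrier} : ℝ) /
    (Nat.card C.carrier * Nat.card D.carrier)

/-- The subhypergroup of the class hypergroup of `G` given by a normal subgroup `N`: the
conjugacy classes that are contained in `N`. -/
def subhyp (N : Subgroup G) : Set (ConjClasses G) := {C | C.carrier ⊆ N}

/-- The coset `C 𝒩`: all classes that are possible outcomes of a product of `C` with some
element of `𝒩`. -/
def hypCoset (C : ConjClasses G) (S : Set (ConjClasses G)) : Set (ConjClasses G) :=
  {E | ∃ D ∈ S, structConst C D E ≠ 0}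

/-- `f` hides the subhypergroup `S`: it is constant on cosets of `S` and takes distinct values on
distinct cosets. -/
def Hides {Λ : Type*} (f : ConjClasses G → Λ) (S : Set (ConjClasses G)) : Prop :=
  ∀ C D, f C = f D ↔ hypCoset C S = hypCoset D S

/-- The weight of a conjugacy class: its cardinality. -/
def clsWeight (C : ConjClasses G) : ℝ := Nat.card C.carrier

end ClassHypergroup

/-! ### Irreducible characters and the quantum Fourier transform of the class hypergroup -/

/-- The irreducible complex characters of `G`. -/
structure Irr (G : Type*) [Group G] where
  char : G → ℂ
  exists_rep : ∃ (d : ℕ) (ρ : Representation ℂ G (Fin d → ℂ)), ρ.IsIrreducible ∧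
    ∀ g, char g = ρ.character g

namespace Irr

variable {G : Type*} [Group G]

theorem char_conj (μ : Irr G) {g h : G} (hgh : IsConj g h) : μ.char g = μ.char h := by
  obtain ⟨d, ρ, -, hρ⟩ := μ.exists_rep
  obtain ⟨c, rfl⟩ := isConj_iff.1 hgh
  rw [hρ, hρ, Representation.char_conj]

theorem trivial_irreducible :
    (Representation.trivial ℂ G (Fin 1 → ℂ)).IsIrreducible := by
  have h1 : IsSimpleOrder (Submodule ℂ (Fin 1 → ℂ)) := by
    have : IsSimpleModule ℂ (Fin 1 → ℂ) := isSimpleModule_iff_finrank_eq_one.2 (by simp)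
    exact (isSimpleModule_iff ..).1 this
  exact
    { exists_pair_ne := ⟨⊥, ⊤, fun h =>
        (bot_ne_top : (⊥ : Submodule ℂ (Fin 1 → ℂ)) ≠ ⊤)
          (congrArg Subrepresentation.toSubmodule h)⟩
      eq_bot_or_eq_top := fun a => (h1.eq_bot_or_eq_top a.toSubmodule).imp
        (fun h => Subrepresentation.toSubmodule_injective h)
        (fun h => Subrepresentation.toSubmodule_injective h) }

/-- The trivial irreducible character. -/
instance : One (Irr G) :=
  ⟨{ char := fun _ => 1
     exists_rep := ⟨1, Representation.trivial ℂ G (Fin 1 → ℂ), trivial_irreducible,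
       fun g => by simp [Representation.character]⟩ }⟩

/-- The kernel of (a representation affording) an irreducible character. -/
def ker (μ : Irr G) : Subgroup G := MonoidHom.ker μ.exists_rep.choose_spec.choose

/-- The weight of an irreducible character: the square of its dimension. -/
def weight (μ : Irr G) : ℝ := ‖μ.char 1‖ ^ 2

/-- The normalized character `𝒳_μ = χ_μ / d_μ`, as a function on conjugacy classes. -/
def normChar (μ : Irr G) (C : ConjClasses G) : ℂ :=
  Quotient.lift (fun g => μ.char g / μ.char 1) (fun _ _ h => by
    simp only [μ.char_conj h]) C

/-- The matrix entry `⟨𝒳_μ| F |C⟩` of the quantum Fourier transform of the class hypergroup. -/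
def qftEntry (μ : Irr G) (C : ConjClasses G) : ℂ :=
  (Real.sqrt (μ.weight * clsWeight C / Nat.card G) : ℂ) * μ.normChar C

end Irr

/-! ### One run of AKR Fourier sampling -/

section AKR

variable {G Λ : Type*} [Group G]

/-- The joint amplitude at `|𝒳_μ⟩|y⟩` after preparing `|𝒳_1⟩`, applying the inverse quantum Fourier
transform, evaluating the oracle `f` into a second register, and applying the quantum Fourier
transform to the first register. -/
def akrAmp (f : ConjClasses G → Λ) (μ : Irr G) (y : Λ) : ℂ :=
  ∑ᶠ (C : ConjClasses G) (_ : f C = y), μ.qftEntry C * conj ((1 : Irr G).qftEntry C)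

/-- The probability that AKR Fourier sampling with oracle `f` yields the label of `μ` (the oracle
register is measured or discarded). -/
def akrProb (f : ConjClasses G → Λ) (μ : Irr G) : ℝ := ∑ᶠ y : Λ, ‖akrAmp f μ y‖ ^ 2

end AKR

/-! ### Quantum circuits -/

/-- Pure states (not necessarily normalized) of qubits placed on the wires `W`. -/
abbrev State (W : Type*) := (W → Bool) → ℂ

/-- The computational basis state `|x⟩`. -/
def ket {W : Type*} (x : W → Bool) : State W :=
  open Classical in fun z => if z = x then 1 else 0

/-- Elementary gates: arbitrary unitaries on one or two qubits. -/
inductive Gate (W : Type*) where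
  | one (i : W) (U : Matrix.unitaryGroup Bool ℂ) : Gate W
  | two (i j : W) (hij : i ≠ j) (U : Matrix.unitaryGroup (Bool × Bool) ℂ) : Gate W

/-- Elementary gates and queries to an oracle that maps bit strings on `I` to bit strings on `O`;
a query specifies the wires that hold the input and the wires that receive the output. -/
inductive OGate (W I O : Type*) where
  | gate (g : Gate W) : OGate W I O
  | query (e : I ⊕ O ↪ W) : OGate W I O

namespace Gate

variable {W W' : Type*}

/-- The action of a gate on states. -/
def apply [DecidableEq W] : Gate W → State W → State W
  | one i U, ψ => fun x => ∑ b : Bool, (U : Matrix Bool Bool ℂ) (x i) b * ψ (Function.update x i b)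
  | two i j _ U, ψ => fun x => ∑ b : Bool × Bool,
      (U : Matrix (Bool × Bool) (Bool × Bool) ℂ) (x i, x j) b *
        ψ (Function.update (Function.update x i b.1) j b.2)

/-- The inverse gate. -/
def inv : Gate W → Gate W
  | one i U => one i U⁻¹
  | two i j h U => two i j h U⁻¹

/-- The same gate with its wires relabelled. -/
def map (e : W ↪ W') : Gate W → Gate W'
  | one i U => one (e i) U
  | two i j h U => two (e i) (e j) (fun h' => h (e.injective h')) U

/-- The swap unitary on two qubits. -/
def swapMatrix : Matrix.unitaryGroup (Bool × Bool) ℂ :=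
  ⟨Matrix.of fun x y => if x = y.swap then 1 else 0, by
    rw [Matrix.mem_unitaryGroup_iff]
    ext ⟨a, b⟩ ⟨c, d⟩
    cases a <;> cases b <;> cases c <;> cases d <;>
      simp [Matrix.mul_apply, Fintype.sum_prod_type]⟩

end Gate

/-- The state after running a circuit. -/
def run {W : Type*} [DecidableEq W] (c : List (Gate W)) (ψ : State W) : State W :=
  c.foldl (fun φ g => g.apply φ) ψ

/-- The inverse circuit. -/
def inverse {W : Type*} (c : List (Gate W)) : List (Gate W) := (c.map Gate.inv).reverse

/-- The action of a gate or of a query to the oracle `F`; a query is the unitary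
`|x⟩|y⟩ ↦ |x⟩|y ⊕ F x⟩`. -/
def OGate.apply {W I O : Type*} [DecidableEq W] (F : (I → Bool) → O → Bool) :
    OGate W I O → State W → State W
  | gate g, ψ => g.apply ψ
  | query e, ψ => fun x => ψ (fun v =>
      open Classical in
      xor (x v) (decide (∃ o, e (Sum.inr o) = v ∧ F (fun i => x (e (Sum.inl i))) o = true)))

/-- The state after running a circuit with queries to the oracle `F`. -/
def orun {W I O : Type*} [DecidableEq W] (F : (I → Bool) → O → Bool)
    (c : List (OGate W I O)) (ψ : State W) : State W :=
  c.foldl (fun φ g => g.apply F φ) ψ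

/-- Use an oracle-free circuit on some of the wires of a larger circuit with oracle. -/
def liftCircuit {W W' I O : Type*} (e : W ↪ W') (c : List (Gate W)) : List (OGate W' I O) :=
  c.map fun g => OGate.gate (g.map e)

/-- The cost of a circuit (with or without queries) on the wires `W`: the number of its qubits,
including ancillas, plus the number of its gates and queries. -/
def cost (W : Type*) [Fintype W] {Γ : Type*} (c : List Γ) : ℕ := Fintype.card W + c.length

/-- Wires of a circuit with an address register `A`, a work register `B` and `w` ancillas. -/
abbrev RegWires (A B : Type*) (w : ℕ) := A ⊕ B ⊕ Fin w

/-- The contents of the registers: address `a`, work register `b`, and all ancillas zero. -/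
def pack {A B : Type*} {w : ℕ} (a : A → Bool) (b : B → Bool) : RegWires A B w → Bool :=
  Sum.elim a (Sum.elim b fun _ => false)

/-! ### Labels of irreducible characters, and subgroups addressed by them -/

/-- A labelling, by strings of `m` bits, of the irreducible characters of the normal subgroups of
`G`, in which the trivial character is labelled by the zero string. -/
structure IrrLabels (G : Type*) [Group G] (m : ℕ) where
  label : ∀ K : Subgroup G, Irr K → Fin m → Bool
  label_injective : ∀ K : Subgroup G, K.Normal → Function.Injective (label K)
  label_one : ∀ K : Subgroup G, label K 1 = fun _ => false

namespace IrrLabels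

variable {G : Type*} [Group G] {m : ℕ} (L : IrrLabels G m)

/-- The subgroup that follows `K` when the irreducible character `μ` of `K` with label `y` has been
sampled: the largest normal subgroup of `G` contained in the kernel of `μ`. -/
def next (K : Subgroup G) (y : Fin m → Bool) : Subgroup G :=
  K ⊓ ⨅ (μ : Irr K) (_ : L.label K μ = y), (μ.ker.map K.subtype).normalCore

/-- The subgroup reached from `G` after the first `t` labels of the sequence `a` of `T` labels. -/
def stage {T : ℕ} (a : Fin T × Fin m → Bool) : ℕ → Subgroup G
  | 0 => ⊤
  | t + 1 => if h : t < T then L.next (stage a t) (fun b => a (⟨t, h⟩, b)) else stage a t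

/-- `a` is an address: each of its `T` entries is the label of an irreducible character of the
subgroup reached before that entry. -/
def IsAddress {T : ℕ} (a : Fin T × Fin m → Bool) : Prop :=
  ∀ t : Fin T, ∃ μ : Irr (L.stage a t), L.label _ μ = fun b => a (t, b)

/-- The subgroup of `G` addressed by a sequence of `T` labels of sampled characters. -/
def subgroupAt {T : ℕ} (a : Fin T × Fin m → Bool) : Subgroup G := L.stage a T

end IrrLabels

/-- The probability that a measurement of the address wires of the state `ψ` in the computational
basis yields an address of the subgroup `N`. -/
def successProb {G W : Type*} [Group G] [Fintype W] {m T : ℕ} (L : IrrLabels G m)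
    (addr : Fin T × Fin m → W) (N : Subgroup G) (ψ : State W) : ℝ :=
  open Classical in
  ∑ x : W → Bool,
    if L.IsAddress (fun p => x (addr p)) ∧ L.subgroupAt (fun p => x (addr p)) = N
    then ‖ψ x‖ ^ 2 else 0

/-! ### Recursive AKR Fourier sampling for the CC-HSHP -/

section Recursive

variable {m T ℓ w : ℕ}

/-- The circuit `c` performs, for all normal subgroups `K ≥ N`, the quantum Fourier transform of
the class hypergroup of `K`: `|a⟩|C⟩|0⟩ ↦ ∑_μ ⟨𝒳_μ|F|C⟩ |a⟩|𝒳_μ⟩|0⟩`, where `a` is an address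
of `K`, and where classes `C` and characters `μ` of `K` are given by their labels. -/
def ComputesClassQFT {G : Type*} [Group G] (L : IrrLabels G m)
    (cls : ∀ K : Subgroup G, ConjClasses K → Fin m → Bool) (N : Subgroup G)
    (c : List (Gate (RegWires (Fin T × Fin m) (Fin m) w))) : Prop :=
  ∀ a : Fin T × Fin m → Bool, L.IsAddress a → N ≤ L.subgroupAt a →
    ∀ C : ConjClasses (L.subgroupAt a), run c (ket (pack a (cls _ C))) = fun x =>
      ∑ᶠ μ : Irr (L.subgroupAt a), μ.qftEntry C * ket (pack a (L.label _ μ)) x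

/-- The wires of the algorithm: address register (one slot for each of the `T` samples), work
register, ancillas, and one register for each of the `T` oracle values. -/
abbrev AlgWires (T m ℓ w : ℕ) := RegWires (Fin T × Fin m) (Fin m) w ⊕ (Fin T × Fin ℓ)

/-- The wires of the query in round `t`: the input consists of the address register (selecting the
subgroup `K`) and of the work register (holding a class of `K`). -/
def queryWires (t : Fin T) : ((Fin T × Fin m) ⊕ Fin m) ⊕ Fin ℓ ↪ AlgWires T m ℓ w where
  toFun := Sum.elim
    (Sum.elim (fun p => Sum.inl (Sum.inl p)) (fun b => Sum.inl (Sum.inr (Sum.inl b))))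
    (fun o => Sum.inr (t, o))
  inj' := by rintro ((_ | _) | _) ((_ | _) | _) <;> simp

/-- Round `t` of the algorithm, one run of AKR Fourier sampling over the currently addressed
subgroup: the work register is in the state `|𝒳_1⟩`; apply the inverse quantum Fourier transform,
the oracle and the quantum Fourier transform; then move the sampled label into slot `t` of the
address register by a swap, which also resets the work register to `|𝒳_1⟩`. -/
def akrRound (c : List (Gate (RegWires (Fin T × Fin m) (Fin m) w))) (t : Fin T) :
    List (OGate (AlgWires T m ℓ w) ((Fin T × Fin m) ⊕ Fin m) (Fin ℓ)) :=
  liftCircuit Function.Embedding.inl (inverse c) ++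
  [OGate.query (queryWires t)] ++
  liftCircuit Function.Embedding.inl c ++
  (List.finRange m).map fun b =>
    OGate.gate (Gate.two (Sum.inl (Sum.inr (Sum.inl b))) (Sum.inl (Sum.inl (t, b))) (by simp)
      Gate.swapMatrix)

/-- Recursive AKR Fourier sampling with `T` rounds. It starts with all wires zero, that is, with
the address of `G` in the address register and `|𝒳_1⟩` in the work register; at the end, the
address register is measured. -/
def recursiveAKR (ℓ : ℕ) (c : List (Gate (RegWires (Fin T × Fin m) (Fin m) w))) :
    List (OGate (AlgWires T m ℓ w) ((Fin T × Fin m) ⊕ Fin m) (Fin ℓ)) :=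
  (List.finRange T).flatMap (akrRound c)

end Recursive

/-! ### The hidden normal subgroup problem with a homomorphism as oracle -/

/-- A choice of a unitary matrix representation for each irreducible character. -/
structure IrrMatrices (G : Type*) [Group G] where
  dim : Irr G → ℕ
  mat : ∀ μ : Irr G, G →* Matrix.unitaryGroup (Fin (dim μ)) ℂ
  trace_mat : ∀ (μ : Irr G) (g : G), Matrix.trace (mat μ g).1 = μ.char g

/-- Labels for the row and column indices of the matrices of the representations `R K`, for the
subgroups `K` of `G`; the only matrix entry of the trivial representation has the zero label. -/
structure IndexLabels {G : Type*} [Group G] (R : ∀ K : Subgroup G, IrrMatrices K) (r : ℕ) where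
  label : ∀ (K : Subgroup G) (μ : Irr K), Fin ((R K).dim μ) × Fin ((R K).dim μ) → Fin r → Bool
  label_injective : ∀ (K : Subgroup G) (μ : Irr K), K.Normal → Function.Injective (label K μ)
  label_one : ∀ (K : Subgroup G) (ij), label K 1 ij = fun _ => false

section Homomorphic

variable {m r T ℓ w ℓ' w' : ℕ}

/-- The circuit `c` performs, for all normal subgroups `K ≥ N`, the quantum Fourier transform of
the group `K`: `|a⟩|g⟩|0⟩ ↦ ∑_{μ,i,j} √(d_μ/|K|) μ(g)_{ij} |a⟩|μ,i,j⟩|0⟩`, where `a` is an address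
of `K`. -/
def ComputesGroupQFT {G : Type*} [Group G] (L : IrrLabels G m)
    (elt : G → Fin m ⊕ Fin r → Bool) (R : ∀ K : Subgroup G, IrrMatrices K) (J : IndexLabels R r)
    (N : Subgroup G) (c : List (Gate (RegWires (Fin T × Fin m) (Fin m ⊕ Fin r) w))) : Prop :=
  ∀ a : Fin T × Fin m → Bool, L.IsAddress a → N ≤ L.subgroupAt a → ∀ g : L.subgroupAt a,
    run c (ket (pack a (elt g))) = fun x =>
      ∑ᶠ s : Σ μ : Irr (L.subgroupAt a), Fin ((R _).dim μ) × Fin ((R _).dim μ),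
        (Real.sqrt ((R _).dim s.1 / Nat.card (L.subgroupAt a)) : ℂ) *
          ((R _).mat s.1 g).1 s.2.1 s.2.2 *
          ket (pack a (Sum.elim (L.label _ s.1) (J.label _ s.1 s.2))) x

/-- The circuit `d` computes, for all normal subgroups `K ≥ N` and with `H_K` the image of `K`
under `f`, the label of the conjugacy class in `H_K` of a given element of `H_K`:
`|a⟩|h⟩|0⟩|0⟩ ↦ |a⟩|h⟩|C_h⟩|0⟩`, where `a` is an address of `K`. -/
def ComputesClasses {G H : Type*} [Group G] [Group H] (f : G →* H) (L : IrrLabels G m)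
    (helt : H → Fin ℓ → Bool) (hcls : ∀ K : Subgroup G, ConjClasses (K.map f) → Fin ℓ' → Bool)
    (N : Subgroup G) (d : List (Gate (RegWires (Fin T × Fin m) (Fin ℓ ⊕ Fin ℓ') w'))) : Prop :=
  ∀ a : Fin T × Fin m → Bool, L.IsAddress a → N ≤ L.subgroupAt a → ∀ h : (L.subgroupAt a).map f,
    run d (ket (pack a (Sum.elim (helt h) fun _ => false))) =
      ket (pack a (Sum.elim (helt h) (hcls _ (ConjClasses.mk h))))

/-- The wires of the algorithm: address register, work register (group elements, or character
labels and matrix indices), ancillas of the Fourier transform; a register for an element of `H`,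
a register for a class in each of the `T` rounds, ancillas of the class computation, and a
register in each round for the discarded matrix indices. -/
abbrev HomWires (T m r ℓ ℓ' w w' : ℕ) :=
  RegWires (Fin T × Fin m) (Fin m ⊕ Fin r) w ⊕
    (Fin ℓ ⊕ (Fin T × Fin ℓ') ⊕ Fin w' ⊕ (Fin T × Fin r))

/-- The wires of a query to `f`. -/
def homQueryWires : (Fin m ⊕ Fin r) ⊕ Fin ℓ ↪ HomWires T m r ℓ ℓ' w w' where
  toFun := Sum.elim (fun b => Sum.inl (Sum.inr (Sum.inl b))) (fun o => Sum.inr (Sum.inl o))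
  inj' := by rintro (_ | _) (_ | _) <;> simp

/-- The wires on which the class computation acts in round `t`. -/
def homClassWires (t : Fin T) :
    RegWires (Fin T × Fin m) (Fin ℓ ⊕ Fin ℓ') w' ↪ HomWires T m r ℓ ℓ' w w' where
  toFun := Sum.elim (fun p => Sum.inl (Sum.inl p)) (Sum.elim
    (Sum.elim (fun b => Sum.inr (Sum.inl b)) (fun b => Sum.inr (Sum.inr (Sum.inl (t, b)))))
    (fun b => Sum.inr (Sum.inr (Sum.inr (Sum.inl b)))))
  inj' := by rintro (_ | (_ | _) | _) (_ | (_ | _) | _) <;> simp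

/-- Round `t`: one run of Fourier sampling over the currently addressed subgroup `K`. The
class-hypergroup oracle `x ↦ C_{f(x)}` is evaluated by querying `f`, computing the class label in
`H_K`, and querying `f` again to erase its value. -/
def homRound (c : List (Gate (RegWires (Fin T × Fin m) (Fin m ⊕ Fin r) w)))
    (d : List (Gate (RegWires (Fin T × Fin m) (Fin ℓ ⊕ Fin ℓ') w'))) (t : Fin T) :
    List (OGate (HomWires T m r ℓ ℓ' w w') (Fin m ⊕ Fin r) (Fin ℓ)) :=
  liftCircuit Function.Embedding.inl (inverse c) ++
  [OGate.query homQueryWires] ++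
  liftCircuit (homClassWires t) d ++
  [OGate.query homQueryWires] ++
  liftCircuit Function.Embedding.inl c ++
  ((List.finRange m).map fun b =>
    OGate.gate (Gate.two (Sum.inl (Sum.inr (Sum.inl (Sum.inl b)))) (Sum.inl (Sum.inl (t, b)))
      (by simp) Gate.swapMatrix)) ++
  (List.finRange r).map fun b =>
    OGate.gate (Gate.two (Sum.inl (Sum.inr (Sum.inl (Sum.inr b))))
      (Sum.inr (Sum.inr (Sum.inr (Sum.inr (t, b))))) (by simp) Gate.swapMatrix)

/-- Recursive Fourier sampling with `T` rounds for a homomorphic oracle. It starts with all wires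
zero; at the end, the address register is measured. -/
def recursiveHom (c : List (Gate (RegWires (Fin T × Fin m) (Fin m ⊕ Fin r) w)))
    (d : List (Gate (RegWires (Fin T × Fin m) (Fin ℓ ⊕ Fin ℓ') w'))) :
    List (OGate (HomWires T m r ℓ ℓ' w w') (Fin m ⊕ Fin r) (Fin ℓ)) :=
  (List.finRange T).flatMap (homRound c d)

end Homomorphic

end HSHP

end

open scoped ComplexConjugate

noncomputable section

namespace HSHP

/-! ### Sums of representations over normal subgroups -/

section Averages

variable {G : Type*} [Group G]

/-! One run of AKR sampling has amplitude `|G|⁻¹ ∑ χ_μ(g)` at `(μ, y)`, the sum running over the `g`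
whose class has oracle value `y` (`akrAmp_eq`). For an oracle that hides `N`, the level sets are the
preimages of the conjugacy classes of `G ⧸ N` (`ConjSep`), so they are unions of cosets of `N`. If
`N` is not in the kernel of `μ`, then `N` has no nonzero fixed vectors, since these form a
subrepresentation; the sum of the representation over `N` is then zero, and every amplitude
vanishes. For trivial `μ` the amplitude is the proportion of `G` in the level set. The probability
is thus a collision probability, at most the largest proportion, and a class of a nontrivial group
contains at most half of the group.

In the recursion every sampled kernel contains `N`, so every addressed subgroup `K` does as well. A
nontrivial label at least halves `|K|`; the trivial one leaves `K` unchanged. Take as potential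
`|K|`, or `0` once `K = N`. Its expectation shrinks by the factor `3/4 = 1/2 + 1/2 * 1/2` in each
round (`IsSamplingRound.sum_potential_ket_le`). A wrong `K` has order at least `2`, so the failure
probability after `4n` rounds is at most `(3/4)^(4n) |G| / 2 ≤ 2^(-k)`.

No measurement occurs between the rounds. Each round writes only into wires that are still zero, so
erasing these wires recovers the basis state before the round. Different branches therefore never
interfere, and squared norms obey the classical recursion (`IsSamplingRound.step`). Unused slots
hold the label of the trivial character, so an unfinished address is already an address of the
current `K`.

For a homomorphism `f`, the class of `f x` in `f(K)` also separates exactly the classes of `K ⧸ N`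
(`conjSep_imageClass`). Matrix entries take the place of characters, and their sums over `N` vanish
for the same `μ` (`IrrMatrices.sum_hom_subgroup`). Both kinds of round satisfy `IsSamplingRound`, to
which the analysis of the chain applies. -/

theorem sum_filter_eq_zero_of_sum_subgroup [Fintype G] {A : Type*} [Ring A] [Module ℂ A]
    (M : G →* A) (N : Subgroup G) [Fintype N] (hM : ∑ n : N, M n = 0) (φ : G → Prop)
    [DecidablePred φ] (hφ : ∀ g, ∀ n ∈ N, φ (g * n) ↔ φ g) :
    ∑ g with φ g, M g = 0 := by
  -- The level set is invariant under `g ↦ g * n`, so each `n` gives another form of the same sum;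
  -- averaging over `n` brings out the factor `∑ M n = 0`.
  have key : ∀ n : N, ∑ g with φ g, M g = ∑ g with φ g, M g * M n := by
    intro n
    rw [Finset.sum_filter, Finset.sum_filter, ← Equiv.sum_comp (Equiv.mulRight (n : G))]
    refine Finset.sum_congr rfl fun g _ => ?_
    simp [hφ g n n.2]
  have h : (Fintype.card N : ℂ) • ∑ g with φ g, M g = 0 := by
    rw [Nat.cast_smul_eq_nsmul]
    calc _ = ∑ n : N, ∑ g with φ g, M g := by simp
      _ = ∑ n : N, ∑ g with φ g, M g * M n := Finset.sum_congr rfl fun n _ => key n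
      _ = 0 := by
        rw [Finset.sum_comm]
        simp [← Finset.mul_sum, hM]
  exact (smul_eq_zero.1 h).resolve_left (by simp [Fintype.card_ne_zero])

/-- Normality makes the `N`-fixed vectors a subrepresentation, so by irreducibility it is zero or
everything. The sum over `N` maps into it, and if it is everything then `N` acts trivially. -/
theorem sum_rep_eq_zero_of_not_le_ker {V : Type*} [AddCommGroup V] [Module ℂ V]
    (ρ : Representation ℂ G V) (hρ : ρ.IsIrreducible) (N : Subgroup G) [N.Normal] [Fintype N]
    (hN : ¬ N ≤ MonoidHom.ker ρ) : ∑ n : N, ρ n = 0 := by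
  let W : Subrepresentation ρ :=
    { toSubmodule :=
        { carrier := {v | ∀ n ∈ N, ρ n v = v}
          add_mem' := fun {a b} ha hb n hn => by rw [map_add, ha n hn, hb n hn]
          zero_mem' := fun n _ => map_zero _
          smul_mem' := fun c v hv n hn => by rw [map_smul, hv n hn] }
      apply_mem_toSubmodule := fun g v hv n hn => by
        have h : n * g = g * (g⁻¹ * n * g) := by group
        have hmem : g⁻¹ * n * g ∈ N := by
          simpa using ‹N.Normal›.conj_mem n hn g⁻¹
        rw [← Module.End.mul_apply, ← map_mul, h, map_mul, Module.End.mul_apply, hv _ hmem] }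
  have hmem : ∀ v, v ∈ W ↔ ∀ n ∈ N, ρ n v = v := fun v => Iff.rfl
  rcases hρ.eq_bot_or_eq_top W with h | h
  · ext1 v
    have hv : (∑ n : N, ρ n) v ∈ W := by
      rw [hmem]
      intro n hn
      rw [← Module.End.mul_apply, Finset.mul_sum]
      congr 1
      exact Fintype.sum_equiv (Equiv.mulLeft (⟨n, hn⟩ : N)) _ _ fun k => by simp
    rw [h] at hv
    exact hv
  · refine absurd (fun n hn => ?_) hN
    rw [MonoidHom.mem_ker]
    ext1 v
    have : v ∈ W := by rw [h]; trivial
    exact (hmem v).1 this n hn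

end Averages

/-! ### Character sums over normal subgroups, and the trivial character. -/

namespace Irr

variable {G : Type*} [Group G] (μ : Irr G)

@[ext] theorem ext_char {μ ν : Irr G} (h : μ.char = ν.char) : μ = ν := by
  cases μ; cases ν; congr

@[simp] theorem one_char (g : G) : (1 : Irr G).char g = 1 := rfl

/-- `ker` depends on a chosen representation; here the same representation affords both the
character and the kernel, which is all that is used about the choice. -/
theorem exists_rep_ker : ∃ (d : ℕ) (ρ : Representation ℂ G (Fin d → ℂ)), ρ.IsIrreducible ∧
    (∀ g, μ.char g = ρ.character g) ∧ μ.ker = MonoidHom.ker ρ :=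
  ⟨_, μ.exists_rep.choose_spec.choose, μ.exists_rep.choose_spec.choose_spec.1,
    μ.exists_rep.choose_spec.choose_spec.2, rfl⟩

theorem exists_char_one : ∃ d : ℕ, d ≠ 0 ∧ μ.char 1 = d := by
  obtain ⟨d, ρ, hρ, hc, -⟩ := μ.exists_rep_ker
  refine ⟨d, ?_, by rw [hc]; simp [Representation.character]⟩
  rintro rfl
  obtain ⟨a, b, hab⟩ := hρ.exists_pair_ne
  refine hab (Subrepresentation.toSubmodule_injective (Subsingleton.elim _ _))

theorem sum_char_subgroup (N : Subgroup G) [N.Normal] [Fintype N] (hN : ¬ N ≤ μ.ker) :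
    ∑ n : N, μ.char n = 0 := by
  obtain ⟨d, ρ, hρ, hc, hk⟩ := μ.exists_rep_ker
  have := sum_rep_eq_zero_of_not_le_ker ρ hρ N (hk ▸ hN)
  simp only [hc, Representation.character]
  rw [← map_sum, this, map_zero]

theorem sum_filter_char [Fintype G] (N : Subgroup G) [N.Normal] (hN : ¬ N ≤ μ.ker)
    (φ : G → Prop) [DecidablePred φ] (hφ : ∀ g, ∀ n ∈ N, φ (g * n) ↔ φ g) :
    ∑ g with φ g, μ.char g = 0 := by
  classical
  obtain ⟨d, ρ, hρ, hc, hk⟩ := μ.exists_rep_ker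
  have h := sum_rep_eq_zero_of_not_le_ker ρ hρ N (hk ▸ hN)
  have h2 := sum_filter_eq_zero_of_sum_subgroup ρ N h φ hφ
  simp only [hc, Representation.character]
  rw [← map_sum, h2, map_zero]

/-- The chosen representation is not inspected: with a proper kernel the sum of the character `1`
over the group would vanish, but it is the order of the group. -/
theorem ker_one [Finite G] : (1 : Irr G).ker = ⊤ := by
  classical
  have := Fintype.ofFinite G
  by_contra h
  have := (1 : Irr G).sum_char_subgroup ⊤ (by rwa [top_le_iff])
  simp at this

theorem eq_one_of_ker_eq_top (h : μ.ker = ⊤) : μ = 1 := by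
  obtain ⟨d, ρ, hρ, hc, hk⟩ := μ.exists_rep_ker
  have htriv : ∀ g, ρ g = 1 := fun g => MonoidHom.mem_ker.1 (by rw [← hk, h]; trivial)
  have hs : IsSimpleModule ℂ (Fin d → ℂ) := by
    obtain ⟨a, b, hab⟩ := hρ.exists_pair_ne
    refine (isSimpleModule_iff ..).2
      { exists_pair_ne := ⟨a.toSubmodule, b.toSubmodule,
          fun h => hab (Subrepresentation.toSubmodule_injective h)⟩
        eq_bot_or_eq_top := fun a => ?_ }
    -- Under a trivial action every subspace is a subrepresentation, so irreducibility forces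
    -- dimension one.
    let a' : Subrepresentation ρ := ⟨a, fun g v hv => by simpa [htriv g] using hv⟩
    exact (hρ.eq_bot_or_eq_top a').imp (fun h => congrArg Subrepresentation.toSubmodule h)
      (fun h => congrArg Subrepresentation.toSubmodule h)
  have hd : d = 1 := by simpa using isSimpleModule_iff_finrank_eq_one.1 hs
  subst hd
  ext g
  rw [hc, Representation.character, htriv g]
  simp

/-- The product of a matrix entry of the class Fourier transform with one of the trivial
character. -/
theorem qftEntry_mul_conj_one [Finite G] (g : G) :
    μ.qftEntry (ConjClasses.mk g) * conj ((1 : Irr G).qftEntry (ConjClasses.mk g)) =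
      (Nat.card (ConjClasses.mk g).carrier / Nat.card G : ℂ) * μ.char g := by
  obtain ⟨d, hd, h1⟩ := μ.exists_char_one
  have hd' : (d : ℂ) ≠ 0 := by exact_mod_cast hd
  have e1 : μ.normChar (ConjClasses.mk g) = μ.char g / d := by rw [← h1]; rfl
  have e2 : (1 : Irr G).normChar (ConjClasses.mk g) = 1 := by
    change (1 : ℂ) / 1 = 1
    simp
  have w1 : μ.weight = d ^ 2 := by simp [weight, h1]
  have w2 : (1 : Irr G).weight = 1 := by simp [weight]
  simp only [qftEntry, e1, e2, w1, w2, clsWeight, one_mul, mul_one, Complex.conj_ofReal]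
  set c : ℝ := (Nat.card (ConjClasses.mk g).carrier : ℝ) with hc
  have hc0 : 0 ≤ c := Nat.cast_nonneg _
  have hs : Real.sqrt (d ^ 2 * c / Nat.card G) = d * Real.sqrt (c / Nat.card G) := by
    rw [mul_div_assoc, Real.sqrt_mul (by positivity), Real.sqrt_sq (by positivity)]
  have hq : (Real.sqrt (c / Nat.card G) : ℂ) * Real.sqrt (c / Nat.card G) =
      (c / Nat.card G : ℂ) := by
    rw [← Complex.ofReal_mul, Real.mul_self_sqrt (by positivity)]
    simp
  have hcC : (Nat.card (ConjClasses.mk g).carrier : ℂ) = (c : ℂ) := by simp [hc]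
  rw [hs, hcC, ← hq]
  push_cast
  field_simp

end Irr

/-! ### One run of AKR sampling: vanishing amplitudes and the trivial outcome. -/

section AKR

variable {G : Type*} [Group G] {Λ : Type*}

/-- Passes from weighted sums over classes to sums over the group, where translation by `N` is
available. -/
theorem sum_conjClasses_eq [Fintype G] [Fintype (ConjClasses G)] {M : Type*} [AddCommGroup M]
    [Module ℂ M] (F : ConjClasses G → M) :
    ∑ C, (Nat.card C.carrier : ℂ) • F C = ∑ g : G, F (ConjClasses.mk g) := by
  classical
  rw [← Finset.sum_fiberwise Finset.univ (fun g : G => ConjClasses.mk g)]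
  refine Finset.sum_congr rfl fun C _ => ?_
  rw [Finset.sum_congr rfl (g := fun _ => F C) (fun g hg => by
    rw [(Finset.mem_filter.1 hg).2]), Finset.sum_const, Nat.cast_smul_eq_nsmul]
  congr 1
  rw [Nat.card_eq_fintype_card, Fintype.card_subtype]
  congr 1
  ext g
  simp [ConjClasses.mem_carrier_iff_mk_eq]

theorem akrAmp_eq [Fintype G] (f : ConjClasses G → Λ) (μ : Irr G) (y : Λ)
    [DecidablePred fun g : G => f (ConjClasses.mk g) = y] :
    akrAmp f μ y = (Nat.card G : ℂ)⁻¹ * ∑ g : G with f (ConjClasses.mk g) = y, μ.char g := by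
  classical
  have := Fintype.ofFinite (ConjClasses G)
  unfold akrAmp
  rw [finsum_eq_sum_of_fintype]
  have h : ∀ C : ConjClasses G,
      (∑ᶠ (_ : f C = y), μ.qftEntry C * conj ((1 : Irr G).qftEntry C)) =
      -- The character is written as `normChar C * char 1` so that it is visibly a function of the
      -- class and not of a representative.
      (Nat.card C.carrier : ℂ) • ((Nat.card G : ℂ)⁻¹ * if f C = y then
        (μ.normChar C * μ.char 1) else 0) := by
    intro C
    obtain ⟨g, rfl⟩ := ConjClasses.exists_rep C
    obtain ⟨d, hd, h1⟩ := μ.exists_char_one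
    have hd' : (d : ℂ) ≠ 0 := by exact_mod_cast hd
    have e1 : μ.normChar (ConjClasses.mk g) = μ.char g / d := by rw [← h1]; rfl
    rw [finsum_eq_if, μ.qftEntry_mul_conj_one g, e1, h1, div_mul_cancel₀ _ hd']
    split_ifs <;> simp; ring
  rw [Finset.sum_congr rfl fun C _ => h C, sum_conjClasses_eq, ← Finset.mul_sum,
    Finset.sum_filter]
  congr 1
  refine Finset.sum_congr rfl fun g _ => ?_
  obtain ⟨d, hd, h1⟩ := μ.exists_char_one
  have hd' : (d : ℂ) ≠ 0 := by exact_mod_cast hd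
  have e1 : μ.normChar (ConjClasses.mk g) = μ.char g / d := by rw [← h1]; rfl
  rw [e1, h1, div_mul_cancel₀ _ hd']
  congr

/-- A class lies in a coset of the subhypergroup of `N` iff the images in `G ⧸ N` are conjugate. -/
theorem mem_hypCoset_iff [Finite G] (N : Subgroup G) [N.Normal] (g e : G) :
    ConjClasses.mk e ∈ hypCoset (ConjClasses.mk g) (subhyp N) ↔
      IsConj (g : G ⧸ N) (e : G ⧸ N) := by
  have hsc : ∀ C D E : ConjClasses G, structConst C D E ≠ 0 ↔
      ∃ a b, a ∈ C.carrier ∧ b ∈ D.carrier ∧ a * b ∈ E.carrier := by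
    intro C D E
    unfold structConst
    rw [div_ne_zero_iff, mul_ne_zero_iff]
    simp only [Nat.cast_ne_zero, ← Nat.pos_iff_ne_zero, Nat.card_pos_iff]
    constructor
    · rintro ⟨⟨⟨⟨a, b⟩, h⟩, -⟩, -⟩
      exact ⟨a, b, h⟩
    · rintro ⟨a, b, h⟩
      exact ⟨⟨⟨⟨a, b⟩, h⟩, inferInstance⟩, ⟨⟨⟨a, h.1⟩⟩, inferInstance⟩, ⟨⟨⟨b, h.2.1⟩⟩, inferInstance⟩⟩
  simp only [hypCoset, Set.mem_ofPred_eq, hsc, ConjClasses.mem_carrier_iff_mk_eq,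
    ConjClasses.mk_eq_mk_iff_isConj]
  constructor
  · rintro ⟨D, hD, a, b, ha, hb, hab⟩
    have hbN : b ∈ N := hD (ConjClasses.mem_carrier_iff_mk_eq.2 hb)
    have h1 := (QuotientGroup.mk' N).map_isConj hab
    have h2 := (QuotientGroup.mk' N).map_isConj ha
    have h3 : QuotientGroup.mk' N (a * b) = QuotientGroup.mk' N a := by
      simpa [QuotientGroup.eq] using hbN
    rw [h3] at h1
    exact (h2.symm.trans h1)
  · intro h
    obtain ⟨x, hx⟩ := isConj_iff.1 h
    obtain ⟨x, rfl⟩ := QuotientGroup.mk_surjective x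
    have hx' : ((x * g * x⁻¹ : G) : G ⧸ N) = e := by simpa using hx
    rw [QuotientGroup.eq] at hx'
    -- The elements `x * g * x⁻¹` and `e` agree modulo `N`; the class of their quotient is the
    -- required member of the subhypergroup.
    refine ⟨ConjClasses.mk ((x * g * x⁻¹)⁻¹ * e), ?_, x * g * x⁻¹, (x * g * x⁻¹)⁻¹ * e, ?_,
      rfl, ?_⟩
    · intro b hb
      have := ConjClasses.mem_carrier_iff_mk_eq.1 hb
      obtain ⟨c, rfl⟩ := isConj_iff.1 (ConjClasses.mk_eq_mk_iff_isConj.1 this).symm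
      exact ‹N.Normal›.conj_mem _ hx' c
    · exact (isConj_iff.2 ⟨x, rfl⟩).symm
    · rw [mul_inv_cancel_left]

theorem hypCoset_eq_iff [Finite G] (N : Subgroup G) [N.Normal] (g h : G) :
    hypCoset (ConjClasses.mk g) (subhyp N) = hypCoset (ConjClasses.mk h) (subhyp N) ↔
      IsConj (g : G ⧸ N) (h : G ⧸ N) := by
  constructor
  · intro heq
    rw [← mem_hypCoset_iff, heq, mem_hypCoset_iff]
  · intro hc
    ext E
    obtain ⟨e, rfl⟩ := ConjClasses.exists_rep E
    rw [mem_hypCoset_iff, mem_hypCoset_iff]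
    exact ⟨fun h' => hc.symm.trans h', fun h' => hc.trans h'⟩

/-- `φ` takes the same value on two elements iff their images in `G ⧸ N` are conjugate. -/
def ConjSep (N : Subgroup G) [N.Normal] (φ : G → Λ) : Prop :=
  ∀ g h : G, φ g = φ h ↔ IsConj (g : G ⧸ N) (h : G ⧸ N)

theorem Hides.conjSep [Finite G] {N : Subgroup G} [N.Normal] {f : ConjClasses G → Λ}
    (hf : Hides f (subhyp N)) : ConjSep N fun g => f (ConjClasses.mk g) :=
  fun g h => (hf _ _).trans (hypCoset_eq_iff N g h)

theorem ConjSep.mul_mem {N : Subgroup G} [N.Normal] {φ : G → Λ} (hφ : ConjSep N φ) (y : Λ) (g : G)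
    (n : G) (hn : n ∈ N) : φ (g * n) = y ↔ φ g = y := by
  have : φ (g * n) = φ g := (hφ _ _).2 (by
    rw [show ((g * n : G) : G ⧸ N) = g by rw [QuotientGroup.eq]; simpa using hn])
  rw [this]

/-- The size of a class divides the order of the group by orbit-stabilizer, and it is a proper
divisor because the identity is conjugate only to itself. -/
theorem two_mul_card_conjClass_le [Finite G] [Nontrivial G] (C : ConjClasses G) :
    2 * Nat.card C.carrier ≤ Nat.card G := by
  classical
  have := Fintype.ofFinite G
  obtain ⟨g, rfl⟩ := ConjClasses.exists_rep C
  have hdvd : Nat.card (ConjClasses.mk g).carrier ∣ Nat.card G := by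
    rw [Nat.card_eq_fintype_card, ConjClasses.card_carrier, Nat.card_eq_fintype_card]
    refine Nat.div_dvd_of_dvd ?_
    rw [← Nat.card_eq_fintype_card, ← Nat.card_eq_fintype_card]
    exact (MulAction.stabilizer (ConjAct G) g).card_subgroup_dvd_card
  obtain ⟨k, hk⟩ := hdvd
  have hne : Nat.card (ConjClasses.mk g).carrier ≠ Nat.card G := by
    intro h
    have huniv : (ConjClasses.mk g).carrier = Set.univ :=
      Set.eq_of_subset_of_ncard_le (Set.subset_univ _) (by
        rw [Set.ncard_univ, ← h]; rfl) (Set.toFinite _)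
    have h1 : (1 : G) ∈ (ConjClasses.mk g).carrier := by rw [huniv]; trivial
    obtain ⟨x, hx⟩ := exists_ne (1 : G)
    have h2 : x ∈ (ConjClasses.mk g).carrier := by rw [huniv]; trivial
    rw [ConjClasses.mem_carrier_iff_mk_eq] at h1 h2
    have := ConjClasses.mk_eq_mk_iff_isConj.1 (h1.trans h2.symm)
    exact hx (isConj_one_right.1 this)
  have hpos : 0 < Nat.card G := Nat.card_pos
  have hk2 : 2 ≤ k := by
    rcases k with _ | _ | k
    · rw [mul_zero] at hk; omega
    · exact absurd (by rw [hk, zero_add, mul_one]) hne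
    · omega
  rw [hk, mul_comm]
  exact Nat.mul_le_mul_left _ hk2

/-- A nonempty level set is the preimage of one class of the nontrivial group `G ⧸ N`, so it has
`|N|` times as many elements as that class. -/
theorem ConjSep.two_mul_card_le [Fintype G] {N : Subgroup G} [N.Normal] (hN : N ≠ ⊤) {φ : G → Λ}
    (hφ : ConjSep N φ) (y : Λ) [DecidablePred fun g => φ g = y] :
    2 * (Finset.univ.filter fun g => φ g = y).card ≤ Nat.card G := by
  classical
  rcases (Finset.univ.filter fun g => φ g = y).eq_empty_or_nonempty with h | ⟨g, hg⟩
  · simp [h]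
  have hgy : φ g = y := (Finset.mem_filter.1 hg).2
  have hnt : Nontrivial (G ⧸ N) := QuotientGroup.nontrivial_iff.2 hN
  have h1 := two_mul_card_conjClass_le (ConjClasses.mk (g : G ⧸ N))
  have h2 : (Finset.univ.filter fun g => φ g = y).card =
      Nat.card (ConjClasses.mk (g : G ⧸ N)).carrier * Nat.card N := by
    have hset : ((Finset.univ.filter fun g => φ g = y) : Set G) =
        (QuotientGroup.mk : G → G ⧸ N) ⁻¹' (ConjClasses.mk (g : G ⧸ N)).carrier := by
      ext h
      rw [Finset.coe_filter, Set.mem_preimage, ConjClasses.mem_carrier_iff_mk_eq,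
        ConjClasses.mk_eq_mk_iff_isConj, ← hφ h g, hgy]
      simp
    rw [← Set.ncard_coe_finset, hset, ← Nat.card_coe_set_eq, 
      Nat.card_congr (QuotientGroup.preimageMkEquivSubgroupProdSet N _), Nat.card_prod, mul_comm]
  rw [h2, Subgroup.card_eq_card_quotient_mul_card_subgroup N, ← mul_assoc]
  exact Nat.mul_le_mul_right _ h1

/-- The square sum of the relative sizes of the level sets is the collision probability; it is at
most `1 / 2` unless `N` is the whole group. -/
theorem ConjSep.sum_sq_le [Fintype G] {N : Subgroup G} [N.Normal] (hN : N ≠ ⊤) {φ : G → Λ}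
    [DecidableEq Λ] (hφ : ConjSep N φ) (s : Finset Λ) :
    ∑ y ∈ s, (((Finset.univ.filter fun g => φ g = y).card : ℝ) / Nat.card G) ^ 2 ≤ 1 / 2 := by
  have hG : (0 : ℝ) < Nat.card G := by exact_mod_cast Nat.card_pos
  calc _ ≤ ∑ y ∈ s, (1 / 2) * (((Finset.univ.filter fun g => φ g = y).card : ℝ) / Nat.card G) := by
        refine Finset.sum_le_sum fun y _ => ?_
        rw [sq]
        refine mul_le_mul_of_nonneg_right ?_ (by positivity)
        rw [div_le_div_iff₀ hG two_pos, one_mul, mul_comm]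
        exact_mod_cast hφ.two_mul_card_le hN y
    _ = (1 / 2) * ((∑ y ∈ s, ((Finset.univ.filter fun g => φ g = y).card : ℝ)) / Nat.card G) := by
        rw [← Finset.mul_sum, Finset.sum_div]
    _ ≤ (1 / 2) * 1 := by
        refine mul_le_mul_of_nonneg_left ?_ (by norm_num)
        rw [div_le_one hG, ← Nat.cast_sum, Nat.card_eq_fintype_card, Nat.cast_le,
          Finset.sum_card_fiberwise_eq_card_filter]
        exact Finset.card_le_univ _
    _ = 1 / 2 := mul_one _

theorem le_ker_of_akrAmp_ne_zero [Finite G] {N : Subgroup G} [N.Normal] {f : ConjClasses G → Λ}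
    (hf : Hides f (subhyp N)) {μ : Irr G} {y : Λ} (h : akrAmp f μ y ≠ 0) : N ≤ μ.ker := by
  classical
  have := Fintype.ofFinite G
  by_contra hN
  rw [akrAmp_eq, μ.sum_filter_char N hN _ (hf.conjSep.mul_mem y), mul_zero] at h
  exact h rfl

theorem akrAmp_one [Fintype G] (f : ConjClasses G → Λ) (y : Λ)
    [DecidablePred fun g : G => f (ConjClasses.mk g) = y] :
    akrAmp f 1 y =
      (((Finset.univ.filter fun g : G => f (ConjClasses.mk g) = y).card : ℝ) / Nat.card G : ℝ) := by
  rw [akrAmp_eq]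
  simp [div_eq_inv_mul]

theorem le_ker_of_akrProb_ne_zero [Finite G] {N : Subgroup G} [N.Normal] {f : ConjClasses G → Λ}
    (hf : Hides f (subhyp N)) {μ : Irr G} (h : akrProb f μ ≠ 0) : N ≤ μ.ker := by
  by_contra hN
  refine h (finsum_eq_zero_of_forall_eq_zero fun y => ?_)
  by_contra hy
  exact hN (le_ker_of_akrAmp_ne_zero hf (y := y) fun h0 => hy (by simp [h0]))

theorem sum_norm_akrAmp_one_sq_le [Finite G] {N : Subgroup G} [N.Normal] (hN : N ≠ ⊤)
    {f : ConjClasses G → Λ} (hf : Hides f (subhyp N)) (s : Finset Λ) :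
    ∑ y ∈ s, ‖akrAmp f 1 y‖ ^ 2 ≤ 1 / 2 := by
  classical
  have := Fintype.ofFinite G
  refine le_trans (le_of_eq ?_) (hf.conjSep.sum_sq_le hN s)
  refine Finset.sum_congr rfl fun y _ => ?_
  rw [akrAmp_one, Complex.norm_real, Real.norm_eq_abs, sq_abs]

theorem akrProb_one_le [Finite G] {N : Subgroup G} [N.Normal] (hN : N ≠ ⊤)
    {f : ConjClasses G → Λ} (hf : Hides f (subhyp N)) : akrProb f 1 ≤ 1 / 2 := by
  classical
  unfold akrProb
  by_cases h : (Function.support fun y : Λ => ‖akrAmp f 1 y‖ ^ 2).Finite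
  · rw [finsum_eq_sum _ h]
    exact sum_norm_akrAmp_one_sq_le hN hf _
  · rw [finsum_of_infinite_support h]
    -- The default value of `finsum` on an infinite support is `0`, so the finiteness of the support
    -- need not be shown.
    norm_num

end AKR

/-! ### Circuits as linear isometries -/

section Lens

variable {X β : Type*} [Fintype β] (upd : X → β → X) (val : X → β)

/-- The action of a matrix on the part of the configuration that `val` reads and `upd` writes. -/
def lensApply (U : Matrix β β ℂ) (ψ : X → ℂ) : X → ℂ := fun x => ∑ b, U (val x) b * ψ (upd x b)

variable {upd val} (h1 : ∀ x b b', upd (upd x b) b' = upd x b') (h2 : ∀ x b, val (upd x b) = b)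
  (h3 : ∀ x, upd x (val x) = x)

include h1 h2 in
-- The laws `h1`, `h2`, `h3` are those of a lens. Along the configurations that differ only in the
-- part read by `val`, the action is plain multiplication by the matrix; one- and two-qubit gates
-- are both of this form.
theorem lensApply_upd (U : Matrix β β ℂ) (ψ : X → ℂ) (x : X) (b : β) :
    lensApply upd val U ψ (upd x b) = U.mulVec (fun b' => ψ (upd x b')) b := by
  simp [lensApply, h1, h2, Matrix.mulVec, dotProduct]

include h1 h2 h3 in
theorem lensApply_mul [DecidableEq β] (U V : Matrix β β ℂ) (ψ : X → ℂ) :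
    lensApply upd val U (lensApply upd val V ψ) = lensApply upd val (U * V) ψ := by
  ext x
  rw [← h3 x, lensApply_upd h1 h2, lensApply_upd h1 h2, ← Matrix.mulVec_mulVec]
  congr 1
  ext b
  rw [lensApply_upd h1 h2]

include h3 in
theorem lensApply_one [DecidableEq β] (ψ : X → ℂ) : lensApply upd val 1 ψ = ψ := by
  ext x
  simp [lensApply, Matrix.one_apply, h3]

include h1 h2 h3 in
-- Writing the new value while keeping the old one, `(x, b) ↦ (upd x b, val x)`, is an involution of
-- `X × β`. It lets a sum over configurations be split into fibres without choosing representatives.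
theorem sum_sum_upd [Fintype X] (φ : X → ℝ) :
    ∑ x, ∑ b, φ (upd x b) = Fintype.card β * ∑ x, φ x := by
  let e : X × β ≃ X × β :=
    { toFun := fun p => (upd p.1 p.2, val p.1)
      invFun := fun p => (upd p.1 p.2, val p.1)
      left_inv := fun p => by simp [h1, h2, h3]
      right_inv := fun p => by simp [h1, h2, h3] }
  rw [← Fintype.sum_prod_type' (f := fun x b => φ (upd x b)),
    show ∑ p : X × β, φ (upd p.1 p.2) = ∑ p, φ (e p).1 from rfl,
    Equiv.sum_comp e (fun p => φ p.1), Fintype.sum_prod_type]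
  simp [Finset.mul_sum]

theorem sum_norm_sq_mulVec [DecidableEq β] (U : Matrix.unitaryGroup β ℂ) (v : β → ℂ) :
    ∑ b, ‖(U : Matrix β β ℂ).mulVec v b‖ ^ 2 = ∑ b, ‖v b‖ ^ 2 := by
  have key : ∀ u : β → ℂ, ((∑ b, ‖u b‖ ^ 2 : ℝ) : ℂ) = star u ⬝ᵥ u := by
    intro u
    simp [dotProduct, ← Complex.conj_mul']
  have : ((∑ b, ‖(U : Matrix β β ℂ).mulVec v b‖ ^ 2 : ℝ) : ℂ) = (∑ b, ‖v b‖ ^ 2 : ℝ) := by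
    rw [key, key, Matrix.star_mulVec, Matrix.dotProduct_mulVec, Matrix.vecMul_vecMul,
      ← Matrix.star_eq_conjTranspose, Matrix.UnitaryGroup.star_mul_self, Matrix.vecMul_one]
  exact_mod_cast this

include h1 h2 h3 in
theorem sum_norm_sq_lensApply [Fintype X] [DecidableEq β] [Nonempty β]
    (U : Matrix.unitaryGroup β ℂ) (ψ : X → ℂ) :
    ∑ x, ‖lensApply upd val U ψ x‖ ^ 2 = ∑ x, ‖ψ x‖ ^ 2 := by
  have hc : (Fintype.card β : ℝ) ≠ 0 := by exact_mod_cast Fintype.card_ne_zero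
  refine mul_left_cancel₀ hc ?_
  rw [← sum_sum_upd h1 h2 h3, ← sum_sum_upd h1 h2 h3]
  refine Finset.sum_congr rfl fun x _ => ?_
  simp_rw [lensApply_upd h1 h2]
  exact sum_norm_sq_mulVec U _

end Lens

/-! ### Gates, queries and circuits acting on basis states. -/

section Gates

variable {W W' I O : Type*} [DecidableEq W] [DecidableEq W']

omit [DecidableEq W] in
theorem ket_apply (x z : W → Bool) [Decidable (z = x)] : ket x z = if z = x then 1 else 0 := by
  unfold ket
  split_ifs <;> rfl

omit [DecidableEq W] in
@[simp] theorem ket_self (x : W → Bool) : ket x x = 1 := by simp [ket]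

namespace Gate

theorem one_apply (i : W) (U : Matrix.unitaryGroup Bool ℂ) (ψ : State W) :
    (one i U).apply ψ = lensApply (fun x b => Function.update x i b) (fun x => x i) U ψ := rfl

theorem two_apply (i j : W) (h : i ≠ j) (U : Matrix.unitaryGroup (Bool × Bool) ℂ) (ψ : State W) :
    (two i j h U).apply ψ =
      lensApply (fun x b => Function.update (Function.update x i b.1) j b.2)
        (fun x => (x i, x j)) U ψ := rfl

theorem update_update_two {i j : W} (h : i ≠ j) (x : W → Bool) (b b' : Bool × Bool) :
    Function.update (Function.update (Function.update (Function.update x i b.1) j b.2) i b'.1) j b'.2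
      = Function.update (Function.update x i b'.1) j b'.2 := by
  rw [Function.update_comm h.symm, Function.update_idem, Function.update_idem]

theorem inv_apply (g : Gate W) (ψ : State W) : g.inv.apply (g.apply ψ) = ψ := by
  cases g with
  | one i U =>
    simp only [inv, one_apply]
    rw [lensApply_mul (by simp) (by simp) (by simp), ← Matrix.UnitaryGroup.mul_val,
      inv_mul_cancel, Matrix.UnitaryGroup.one_val, lensApply_one (by simp)]
  | two i j h U =>
    simp only [inv, two_apply]
    rw [lensApply_mul (fun x b b' => update_update_two h x b b') (by simp [h]) (by simp),
      ← Matrix.UnitaryGroup.mul_val, inv_mul_cancel, Matrix.UnitaryGroup.one_val,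
      lensApply_one (by simp)]

theorem sum_norm_sq_apply [Fintype W] (g : Gate W) (ψ : State W) :
    ∑ x, ‖g.apply ψ x‖ ^ 2 = ∑ x, ‖ψ x‖ ^ 2 := by
  cases g with
  | one i U => exact sum_norm_sq_lensApply (by simp) (by simp) (by simp) U ψ
  | two i j h U =>
    exact sum_norm_sq_lensApply (fun x b b' => update_update_two h x b b') (by simp [h])
      (by simp) U ψ

theorem apply_linear (g : Gate W) : IsLinearMap ℂ g.apply := by
  cases g <;> constructor <;> intros <;> ext x <;>
    simp only [Gate.apply, Pi.add_apply, Pi.smul_apply, smul_eq_mul, mul_add,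
      Finset.sum_add_distrib, Finset.mul_sum] <;>
    refine Finset.sum_congr rfl fun b _ => ?_ <;> ring

theorem swap_apply_ket (i j : W) (h : i ≠ j) (z : W → Bool) :
    (two i j h swapMatrix).apply (ket z) = ket (z ∘ Equiv.swap i j) := by
  ext x
  have hx : Function.update (Function.update x i (x j)) j (x i) = x ∘ Equiv.swap i j := by
    ext v
    rcases eq_or_ne v j with rfl | hj
    · simp
    rcases eq_or_ne v i with rfl | hi
    · simp [h]
    · simp [hi, hj, Equiv.swap_apply_of_ne_of_ne hi hj]
  have hU : ∀ b : Bool × Bool, (swapMatrix : Matrix (Bool × Bool) (Bool × Bool) ℂ) (x i, x j) b =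
      if b = (x j, x i) then 1 else 0 := by
    intro b
    simp only [swapMatrix, Matrix.of_apply]
    congr 1
    rw [eq_iff_iff]
    constructor
    · rintro h; rw [← Prod.swap_swap b, ← h]; rfl
    · rintro rfl; rfl
  simp only [Gate.apply, hU, ite_mul, one_mul, zero_mul, Finset.sum_ite_eq', Finset.mem_univ,
    if_true, hx]
  classical
  rw [ket_apply, ket_apply]
  congr 1
  rw [eq_iff_iff]
  constructor
  · rintro rfl; ext v; simp
  · rintro rfl; ext v; simp

end Gate

variable (F : (I → Bool) → O → Bool)

/-- The permutation of the configurations given by a query. -/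
def queryMap (e : I ⊕ O ↪ W) (x : W → Bool) : W → Bool := fun v =>
  open Classical in
  xor (x v) (decide (∃ o, e (Sum.inr o) = v ∧ F (fun i => x (e (Sum.inl i))) o = true))

theorem query_apply (e : I ⊕ O ↪ W) (ψ : State W) (x : W → Bool) :
    (OGate.query e).apply F ψ x = ψ (queryMap F e x) := rfl

omit [DecidableEq W] in
theorem queryMap_inl (e : I ⊕ O ↪ W) (x : W → Bool) (i : I) :
    queryMap F e x (e (Sum.inl i)) = x (e (Sum.inl i)) := by
  simp [queryMap]

omit [DecidableEq W] in
theorem queryMap_inr (e : I ⊕ O ↪ W) (x : W → Bool) (o : O) :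
    queryMap F e x (e (Sum.inr o)) = xor (x (e (Sum.inr o))) (F (fun i => x (e (Sum.inl i))) o) := by
  simp [queryMap]

omit [DecidableEq W] in
theorem queryMap_of_forall_ne (e : I ⊕ O ↪ W) (x : W → Bool) (v : W)
    (hv : ∀ o, e (Sum.inr o) ≠ v) : queryMap F e x v = x v := by
  simp [queryMap, hv]

omit [DecidableEq W] in
-- A query leaves its input wires alone, so a second query adds the same value again. Hence it makes
-- no difference that the action on states is defined by pulling back configurations.
theorem queryMap_involutive (e : I ⊕ O ↪ W) : Function.Involutive (queryMap F e) := by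
  intro x
  ext v
  by_cases hv : ∃ o, e (Sum.inr o) = v
  · obtain ⟨o, rfl⟩ := hv
    rw [queryMap_inr, queryMap_inr]
    simp only [queryMap_inl]
    simp
  · push Not at hv
    rw [queryMap_of_forall_ne F e _ v hv, queryMap_of_forall_ne F e _ v hv]

theorem query_apply_ket (e : I ⊕ O ↪ W) (z : W → Bool) :
    (OGate.query e).apply F (ket z) = ket (queryMap F e z) := by
  classical
  ext x
  rw [query_apply, ket_apply, ket_apply]
  congr 1
  rw [eq_iff_iff]
  constructor
  · rintro rfl; exact (queryMap_involutive F e x).symm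
  · rintro rfl; exact queryMap_involutive F e z

theorem OGate.sum_norm_sq_apply [Fintype W] (g : OGate W I O) (ψ : State W) :
    ∑ x, ‖g.apply F ψ x‖ ^ 2 = ∑ x, ‖ψ x‖ ^ 2 := by
  cases g with
  | gate g => exact g.sum_norm_sq_apply ψ
  | query e =>
    exact Equiv.sum_comp (queryMap_involutive F e).toPerm (fun x => ‖ψ x‖ ^ 2)

theorem OGate.apply_linear (g : OGate W I O) : IsLinearMap ℂ (g.apply F) := by
  cases g with
  | gate g => exact g.apply_linear
  | query e => exact ⟨fun _ _ => rfl, fun _ _ => rfl⟩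

theorem orun_cons (g : OGate W I O) (c : List (OGate W I O)) (ψ : State W) :
    orun F (g :: c) ψ = orun F c (g.apply F ψ) := rfl

theorem orun_append (c c' : List (OGate W I O)) (ψ : State W) :
    orun F (c ++ c') ψ = orun F c' (orun F c ψ) := by
  simp [orun, List.foldl_append]

theorem orun_linear (c : List (OGate W I O)) : IsLinearMap ℂ (orun F c) := by
  induction c with
  | nil => exact ⟨fun _ _ => rfl, fun _ _ => rfl⟩
  | cons g c ih =>
    constructor
    · intro x y
      rw [orun_cons, (g.apply_linear F).map_add, ih.map_add]; rfl
    · intro a x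
      rw [orun_cons, (g.apply_linear F).map_smul, ih.map_smul]; rfl

theorem sum_norm_sq_orun [Fintype W] (c : List (OGate W I O)) (ψ : State W) :
    ∑ x, ‖orun F c ψ x‖ ^ 2 = ∑ x, ‖ψ x‖ ^ 2 := by
  induction c generalizing ψ with
  | nil => rfl
  | cons g c ih => rw [orun_cons, ih, g.sum_norm_sq_apply]

theorem orun_sum_smul (c : List (OGate W I O)) {ι : Type*} (s : Finset ι) (α : ι → ℂ)
    (ψ : ι → State W) : orun F c (∑ i ∈ s, α i • ψ i) = ∑ i ∈ s, α i • orun F c (ψ i) := by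
  have := map_sum ((orun_linear F c).mk') (fun i => α i • ψ i) s
  simpa only [IsLinearMap.mk'_apply, (orun_linear F c).map_smul] using this

theorem run_linear (c : List (Gate W)) : IsLinearMap ℂ (run c) := by
  induction c with
  | nil => exact ⟨fun _ _ => rfl, fun _ _ => rfl⟩
  | cons g c ih =>
    have hc : ∀ ψ, run (g :: c) ψ = run c (g.apply ψ) := fun _ => rfl
    constructor
    · intro x y
      rw [hc, g.apply_linear.map_add, ih.map_add]; rfl
    · intro a x
      rw [hc, g.apply_linear.map_smul, ih.map_smul]; rfl

theorem run_sum_smul (c : List (Gate W)) {ι : Type*} (s : Finset ι) (α : ι → ℂ)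
    (ψ : ι → State W) : run c (∑ i ∈ s, α i • ψ i) = ∑ i ∈ s, α i • run c (ψ i) := by
  have := map_sum ((run_linear c).mk') (fun i => α i • ψ i) s
  simpa only [IsLinearMap.mk'_apply, (run_linear c).map_smul] using this

theorem run_inverse (c : List (Gate W)) (ψ : State W) : run (inverse c) (run c ψ) = ψ := by
  induction c generalizing ψ with
  | nil => rfl
  | cons g c ih =>
    have : inverse (g :: c) = inverse c ++ [g.inv] := by simp [inverse]
    rw [this]
    simp only [run, List.foldl_append] at ih ⊢
    simp only [List.foldl_cons, List.foldl_nil]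
    rw [ih, g.inv_apply]

/-! ### Circuits on some of the wires -/

omit [DecidableEq W] [DecidableEq W'] in
theorem extend_comp_self (e : W ↪ W') (u : W → Bool) (x : W' → Bool) :
    Function.extend e u x ∘ e = u := by
  ext i; simp [e.injective.extend_apply]

/-- `Function.extend e u x` is the configuration that reads `u` on the wires of the small circuit
and `x` on the others; this is how a small circuit is viewed inside a larger one. -/
theorem extend_update (e : W ↪ W') (u : W → Bool) (x : W' → Bool) (i : W) (b : Bool) :
    Function.extend e (Function.update u i b) x =
      Function.update (Function.extend e u x) (e i) b := by
  ext v
  by_cases hv : ∃ i, e i = v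
  · obtain ⟨j, rfl⟩ := hv
    rw [e.injective.extend_apply]
    by_cases hj : j = i
    · subst hj; simp
    · rw [Function.update_of_ne hj, Function.update_of_ne (e.injective.ne hj),
        e.injective.extend_apply]
  · rw [Function.extend_apply' _ _ _ hv, Function.update_of_ne (fun h => hv ⟨i, h.symm⟩),
      Function.extend_apply' _ _ _ hv]

theorem Gate.map_apply (e : W ↪ W') (g : Gate W) (ψ : State W') (u : W → Bool) (x : W' → Bool) :
    (g.map e).apply ψ (Function.extend e u x) =
      g.apply (fun u' => ψ (Function.extend e u' x)) u := by
  cases g <;> simp [Gate.map, Gate.apply, extend_update, e.injective.extend_apply]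

/-- The outer wires are mere parameters: on each slice with fixed outer contents the lifted circuit
is the original one. -/
theorem orun_liftCircuit (e : W ↪ W') (c : List (Gate W)) (ψ : State W') (u : W → Bool)
    (x : W' → Bool) :
    orun F (liftCircuit e c) ψ (Function.extend e u x) =
      run c (fun u' => ψ (Function.extend e u' x)) u := by
  induction c generalizing ψ with
  | nil => rfl
  | cons g c ih =>
    change orun F (liftCircuit e c) ((g.map e).apply ψ) _ = run c (g.apply _) u
    rw [ih]
    congr 1
    ext u'
    exact g.map_apply e ψ u' x

omit [DecidableEq W] [DecidableEq W'] in
open Classical in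
theorem ket_extend (e : W ↪ W') (z x : W' → Bool) (u u' : W → Bool) :
    ket (Function.extend e u z) (Function.extend e u' x) =
      if (∀ v, v ∉ Set.range e → x v = z v) then ket u u' else 0 := by
  rw [ket_apply, ket_apply, ← ite_and]
  congr 1
  rw [eq_iff_iff]
  constructor
  · intro h
    refine ⟨fun v hv => ?_, ?_⟩
    · have := congrFun h v
      rwa [Function.extend_apply' _ _ _ hv, Function.extend_apply' _ _ _ hv] at this
    · rw [← extend_comp_self e u' x, h, extend_comp_self]
  · rintro ⟨h, rfl⟩
    ext v
    by_cases hv : ∃ i, e i = v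
    · obtain ⟨j, rfl⟩ := hv
      rw [e.injective.extend_apply, e.injective.extend_apply]
    · rw [Function.extend_apply' _ _ _ hv, Function.extend_apply' _ _ _ hv, h v hv]

/-- A circuit on some of the wires acts on basis states by changing the contents of these wires. -/
theorem orun_liftCircuit_ket (e : W ↪ W') (c : List (Gate W)) (z : W' → Bool) {ι : Type*}
    (s : Finset ι) (α : ι → ℂ) (u : ι → W → Bool)
    (h : run c (ket (z ∘ e)) = ∑ i ∈ s, α i • ket (u i)) :
    orun F (liftCircuit e c) (ket z) = ∑ i ∈ s, α i • ket (Function.extend e (u i) z) := by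
  classical
  ext x
  have hext : ∀ x : W' → Bool, Function.extend e (x ∘ e) x = x := by
    intro x
    ext v
    by_cases hv : ∃ i, e i = v
    · obtain ⟨j, rfl⟩ := hv
      rw [e.injective.extend_apply]; rfl
    · rw [Function.extend_apply' _ _ _ hv]
  rw [← hext x, orun_liftCircuit]
  -- A slice of a basis state is a basis state if the outer wires agree with `z`, and zero
  -- otherwise.
  have : (fun u' => ket z (Function.extend e u' x)) =
      (if (∀ v, v ∉ Set.range e → x v = z v) then 1 else 0 : ℂ) • ket (z ∘ e) := by
    ext u'
    conv_lhs => rw [← hext z]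
    rw [ket_extend]
    simp
  rw [this, (run_linear c).map_smul, h]
  have hket : ∀ i, ket (Function.extend e (u i) z) x =
      (if (∀ v, v ∉ Set.range e → x v = z v) then 1 else 0 : ℂ) * ket (u i) (x ∘ e) := by
    intro i
    conv_lhs => rw [← hext x]
    rw [ket_extend]
    simp
  rw [hext]
  simp only [Pi.smul_apply, Finset.sum_apply, Finset.mul_sum, hket, smul_eq_mul]
  exact Finset.sum_congr rfl fun i _ => by ring

/-! ### Swapping registers -/

/-- The final configuration `z'` is prescribed wire by wire, so it stays fixed in the induction
while `z` absorbs the first swap; the pairs are disjoint, hence the remaining ones are unaffected.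
-/
theorem orun_swaps {ι : Type*} (u v : ι → W) (hu : Function.Injective u)
    (hv : Function.Injective v) (huv : ∀ i j, u i ≠ v j) (l : List ι) (hl : l.Nodup)
    (z z' : W → Bool) (h1 : ∀ i ∈ l, z' (u i) = z (v i)) (h2 : ∀ i ∈ l, z' (v i) = z (u i))
    (h3 : ∀ x, (∀ i ∈ l, x ≠ u i ∧ x ≠ v i) → z' x = z x) :
    orun F (l.map fun b => OGate.gate (Gate.two (u b) (v b) (huv b b) Gate.swapMatrix)) (ket z) =
      ket z' := by
  induction l generalizing z with
  | nil =>
    have : z' = z := funext fun x => h3 x (by simp)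
    rw [this]; rfl
  | cons b l ih =>
    rw [List.map_cons, orun_cons]
    change orun F _ ((Gate.two (u b) (v b) (huv b b) Gate.swapMatrix).apply (ket z)) = _
    rw [Gate.swap_apply_ket]
    have hb : b ∉ l := (List.nodup_cons.1 hl).1
    have hne : ∀ i ∈ l, i ≠ b := fun i hi h => hb (h ▸ hi)
    refine ih (List.nodup_cons.1 hl).2 _ ?_ ?_ ?_
    · intro i hi
      rw [h1 i (List.mem_cons_of_mem _ hi), Function.comp_apply,
        Equiv.swap_apply_of_ne_of_ne (huv b i).symm (hv.ne (hne i hi))]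
    · intro i hi
      rw [h2 i (List.mem_cons_of_mem _ hi), Function.comp_apply,
        Equiv.swap_apply_of_ne_of_ne (hu.ne (hne i hi)) (huv i b)]
    · intro x hx
      rw [Function.comp_apply]
      by_cases hxu : x = u b
      · subst hxu
        rw [Equiv.swap_apply_left, h1 b List.mem_cons_self]
      by_cases hxv : x = v b
      · subst hxv
        rw [Equiv.swap_apply_right, h2 b List.mem_cons_self]
      rw [Equiv.swap_apply_of_ne_of_ne hxu hxv]
      refine h3 x fun i hi => ?_
      rcases List.mem_cons.1 hi with rfl | hi
      · exact ⟨hxu, hxv⟩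
      · exact hx i hi

end Gates

/-! ### Addresses -/

namespace IrrLabels

variable {G : Type*} [Group G] {m T : ℕ} (L : IrrLabels G m)

theorem next_le (K : Subgroup G) (y : Fin m → Bool) : L.next K y ≤ K := inf_le_left

theorem next_normal (K : Subgroup G) [K.Normal] (y : Fin m → Bool) : (L.next K y).Normal := by
  unfold next
  have h : (⨅ (μ : Irr K) (_ : L.label K μ = y), (μ.ker.map K.subtype).normalCore).Normal :=
    Subgroup.normal_iInf_normal fun μ =>
      Subgroup.normal_iInf_normal fun _ => Subgroup.normalCore_normal _
  exact Subgroup.normal_inf_normal _ _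

theorem next_label (K : Subgroup G) [K.Normal] (μ : Irr K) :
    L.next K (L.label K μ) = (μ.ker.map K.subtype).normalCore := by
  have h : (⨅ (ν : Irr K) (_ : L.label K ν = L.label K μ), (ν.ker.map K.subtype).normalCore) =
      (μ.ker.map K.subtype).normalCore := by
    refine le_antisymm (iInf_le_of_le μ (iInf_le_of_le rfl le_rfl))
      (le_iInf fun ν => le_iInf fun hν => ?_)
    rw [L.label_injective K inferInstance hν]
  rw [next, h, inf_eq_right]
  exact (Subgroup.normalCore_le _).trans (Subgroup.map_subtype_le _)

theorem le_next {N K : Subgroup G} [N.Normal] [K.Normal] (hN : N ≤ K) (μ : Irr K)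
    (hμ : N.subgroupOf K ≤ μ.ker) : N ≤ L.next K (L.label K μ) := by
  rw [next_label, Subgroup.normal_le_normalCore]
  intro n hn
  exact ⟨⟨n, hN hn⟩, hμ (Subgroup.mem_subgroupOf.2 hn), rfl⟩

/-- This is why empty slots are harmless: they name the trivial character, whose kernel is all of
`K`. -/
theorem next_zero [Finite G] (K : Subgroup G) [K.Normal] : L.next K (fun _ => false) = K := by
  rw [← L.label_one K, next_label, Irr.ker_one, ← MonoidHom.range_eq_map, Subgroup.range_subtype,
    Subgroup.normalCore_eq_self]

/-- A nontrivial character has a proper kernel, and a proper subgroup has index at least two. -/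
theorem two_mul_card_next_le [Finite G] (K : Subgroup G) [K.Normal] (μ : Irr K) (hμ : μ ≠ 1) :
    2 * Nat.card (L.next K (L.label K μ)) ≤ Nat.card K := by
  have hle : L.next K (L.label K μ) ≤ K := L.next_le _ _
  obtain ⟨k, hk⟩ := Subgroup.card_dvd_of_le hle
  have hne : Nat.card (L.next K (L.label K μ)) ≠ Nat.card K := by
    intro h
    have heq := Subgroup.eq_of_le_of_card_ge hle h.ge
    rw [next_label] at heq
    refine hμ (μ.eq_one_of_ker_eq_top (top_le_iff.1 fun g _ => ?_))
    have hg : (g : G) ∈ μ.ker.map K.subtype :=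
      Subgroup.normalCore_le _ (heq.symm ▸ g.2)
    obtain ⟨g', hg', he⟩ := hg
    rwa [← Subtype.ext (show (g' : G) = g from he)]
  have hpos : 0 < Nat.card K := Nat.card_pos
  have hk2 : 2 ≤ k := by
    rcases k with _ | _ | k
    · rw [mul_zero] at hk; omega
    · exact absurd (by rw [hk, zero_add, mul_one]) hne
    · omega
  rw [hk, mul_comm]
  exact Nat.mul_le_mul_left _ hk2

theorem stage_succ (a : Fin T × Fin m → Bool) (t : Fin T) :
    L.stage a (t + 1) = L.next (L.stage a t) fun b => a (t, b) := by
  rw [stage, dif_pos t.2]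

theorem stage_normal (a : Fin T × Fin m → Bool) (t : ℕ) : (L.stage a t).Normal := by
  induction t with
  | zero => rw [stage]; infer_instance
  | succ t ih =>
    rw [stage]
    split_ifs
    · exact L.next_normal _ _
    · exact ih

instance subgroupAt_normal (a : Fin T × Fin m → Bool) : (L.subgroupAt a).Normal :=
  L.stage_normal a T

theorem stage_congr {a a' : Fin T × Fin m → Bool} (t : ℕ)
    (h : ∀ s : Fin T, (s : ℕ) < t → ∀ b, a (s, b) = a' (s, b)) : L.stage a t = L.stage a' t := by
  induction t with
  | zero => rfl
  | succ t ih =>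
    rw [stage, stage, ih fun s hs => h s (by omega)]
    split_ifs with ht
    · congr 1
      ext b
      exact h ⟨t, ht⟩ (by simp) b
    · rfl

theorem stage_eq_of_zero [Finite G] {a : Fin T × Fin m → Bool} (t : ℕ)
    (h : ∀ s : Fin T, t ≤ s → ∀ b, a (s, b) = false) (s : ℕ) (hs : t ≤ s) :
    L.stage a s = L.stage a t := by
  induction s, hs using Nat.le_induction with
  | base => rfl
  | succ s hs ih =>
    rw [stage]
    split_ifs with hT
    · have := L.stage_normal a s
      rw [show (fun b => a (⟨s, hT⟩, b)) = fun _ => false from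
        funext fun b => h ⟨s, hT⟩ hs b, next_zero, ih]
    · exact ih

/-- Storing the label of a sampled character in the first unused slot of an address. -/
theorem isAddress_update [Finite G] {a a' : Fin T × Fin m → Bool} (t : Fin T)
    (ha : L.IsAddress a) (h0 : ∀ s : Fin T, t ≤ s → ∀ b, a (s, b) = false)
    (hs : ∀ s : Fin T, s ≠ t → ∀ b, a' (s, b) = a (s, b)) (μ : Irr (L.subgroupAt a))
    (ht : ∀ b, a' (t, b) = L.label _ μ b) :
    L.IsAddress a' ∧ L.subgroupAt a' = L.next (L.subgroupAt a) (L.label _ μ) := by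
  -- The slots from `t` on are empty, so the whole address already names the subgroup of stage `t`.
  have hK : L.subgroupAt a = L.stage a t := L.stage_eq_of_zero t h0 T t.2.le
  have hst : ∀ s : ℕ, s ≤ t → L.stage a' s = L.stage a s := fun s hs' =>
    L.stage_congr s fun r hr b => hs r (fun h => by subst h; omega) b
  have h0' : ∀ s : Fin T, (t : ℕ) + 1 ≤ s → ∀ b, a' (s, b) = false := fun s hs' b => by
    rw [hs s (fun h => by subst h; omega), h0 s (by rw [Fin.le_def]; omega)]
  have hnext : L.stage a' (t + 1) = L.next (L.subgroupAt a) (L.label _ μ) := by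
    rw [stage_succ, hst t le_rfl, ← hK, show (fun b => a' (t, b)) = L.label _ μ from funext ht]
  refine ⟨fun s => ?_, ?_⟩
  · rcases lt_trichotomy s t with h | h | h
    · rw [hst s (Fin.le_def.1 h.le), show (fun b => a' (s, b)) = fun b => a (s, b) from
        funext fun b => hs s h.ne b]
      exact ha s
    · subst h
      rw [hst s le_rfl, ← hK]
      exact ⟨μ, (funext ht).symm⟩
    · refine ⟨1, ?_⟩
      rw [L.label_one]
      exact (funext fun b => h0' s (by rw [Fin.lt_def] at h; omega) b).symm
  · rw [subgroupAt, L.stage_eq_of_zero _ h0' T t.2, hnext]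

theorem isAddress_zero : L.IsAddress (fun _ : Fin T × Fin m => false) :=
  fun _ => ⟨1, L.label_one _⟩

theorem subgroupAt_zero [Finite G] : L.subgroupAt (fun _ : Fin T × Fin m => false) = ⊤ :=
  L.stage_eq_of_zero 0 (fun _ _ _ => rfl) T (Nat.zero_le _)

end IrrLabels

/-! ### The chain of sampled subgroups -/

section Chain

variable {G : Type*} [Group G] [Finite G] {m T : ℕ} (L : IrrLabels G m) {W I O : Type*}
  [Fintype W] [DecidableEq W] (F : (I → Bool) → O → Bool)
  (addr : Fin T × Fin m → W) (slot : W → Option (Fin T)) (N : Subgroup G)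

/-- A basis state before round `t`: all wires not used in earlier rounds are zero, and the address
register holds an address of a subgroup that contains `N`. -/
structure ValidAt (t : ℕ) (x : W → Bool) : Prop where
  clean : ∀ v, (∀ s, slot v = some s → t ≤ s) → x v = false
  isAddress : L.IsAddress fun p => x (addr p)
  le : N ≤ L.subgroupAt fun p => x (addr p)

/-- A potential that vanishes at the addresses of `N` and is the order of the addressed subgroup
otherwise. -/
def potential (x : W → Bool) : ℝ :=
  open Classical in
  if L.subgroupAt (fun p => x (addr p)) = N then 0
  else Nat.card (L.subgroupAt fun p => x (addr p))

/-- The circuit `r` performs round `t`: from a valid basis state, it only changes the wires of slot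
`t`, where it stores the label of a character with `N` in its kernel, and this character is trivial
with probability at most `1 / 2` unless `N` is already reached. -/
def IsSamplingRound (t : Fin T) (r : List (OGate W I O)) : Prop :=
  ∀ x, ValidAt L addr slot N t x →
    (∀ x', orun F r (ket x) x' ≠ 0 → (∀ v, slot v ≠ some t → x' v = x v) ∧
      ∃ μ : Irr (L.subgroupAt fun p => x (addr p)), N.subgroupOf _ ≤ μ.ker ∧
        ∀ b, x' (addr (t, b)) = L.label _ μ b) ∧
    (N ≠ L.subgroupAt (fun p => x (addr p)) →
      ∑ x' with ∀ b, x' (addr (t, b)) = false, ‖orun F r (ket x) x'‖ ^ 2 ≤ 1 / 2)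

variable {L F addr slot N}

omit [Finite G] [Fintype W] [DecidableEq W] in
theorem potential_nonneg (x : W → Bool) : 0 ≤ potential L addr N x := by
  unfold potential
  split_ifs
  · exact le_rfl
  · positivity

theorem sum_norm_sq_ket (x : W → Bool) : ∑ z, ‖ket x z‖ ^ 2 = 1 := by
  classical
  rw [Finset.sum_eq_single x]
  · simp
  · intro z _ hz; simp [ket_apply, hz]
  · simp

/-- Since `N` lies in the sampled kernel and is normal in `G`, it lies in the next subgroup. That
subgroup is contained in the present one, with index at least two for a nonzero label. -/
theorem IsSamplingRound.validAt [N.Normal] (haddr : ∀ p, slot (addr p) = some p.1) {t : Fin T}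
    {r : List (OGate W I O)} (hr : IsSamplingRound L F addr slot N t r) {x x' : W → Bool}
    (hx : ValidAt L addr slot N t x) (h : orun F r (ket x) x' ≠ 0) :
    ValidAt L addr slot N (t + 1) x' ∧ potential L addr N x' ≤ potential L addr N x ∧
      ((¬ ∀ b, x' (addr (t, b)) = false) → potential L addr N x' ≤ potential L addr N x / 2) := by
  obtain ⟨hoff, μ, hμ, hlab⟩ := (hr x hx).1 x' h
  obtain ⟨h1, h2⟩ := L.isAddress_update (a := fun p => x (addr p)) (a' := fun p => x' (addr p)) t
    hx.isAddress (fun s hs b => hx.clean _ fun s' hs' => by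
      rw [haddr] at hs'; cases hs'; exact hs)
    (fun s hs b => hoff _ (by rw [haddr]; simpa using hs)) μ hlab
  have hle := L.le_next hx.le μ hμ
  refine ⟨⟨fun v hv => ?_, h1, h2 ▸ hle⟩, ?_, fun hne => ?_⟩
  · rw [hoff v fun h => by have := hv _ h; omega]
    exact hx.clean v fun s hs => (Nat.le_succ _).trans (hv s hs)
  · unfold potential
    rw [h2]
    split_ifs with h3 h4 h4
    · exact le_rfl
    · positivity
    -- Once `N` is reached it is never left: the next subgroup lies between `N` and `N`.
    · exact absurd (le_antisymm ((L.next_le _ _).trans h4.le) hle) h3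
    · exact_mod_cast Nat.le_of_dvd Nat.card_pos (Subgroup.card_dvd_of_le (L.next_le _ _))
  · have hμ1 : μ ≠ 1 := by
      rintro rfl
      exact hne fun b => by rw [hlab, L.label_one]
    have h2c := L.two_mul_card_next_le _ μ hμ1
    unfold potential
    rw [h2]
    split_ifs with h3 h4 h4
    · simp
    · positivity
    · exact absurd (le_antisymm ((L.next_le _ _).trans h4.le) hle) h3
    · rw [le_div_iff₀ two_pos, mul_comm]
      exact_mod_cast h2c

theorem IsSamplingRound.sum_potential_ket_le [N.Normal] (haddr : ∀ p, slot (addr p) = some p.1)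
    {t : Fin T} {r : List (OGate W I O)} (hr : IsSamplingRound L F addr slot N t r)
    {x : W → Bool} (hx : ValidAt L addr slot N t x) :
    ∑ x', potential L addr N x' * ‖orun F r (ket x) x'‖ ^ 2 ≤ 3 / 4 * potential L addr N x := by
  set ψ := orun F r (ket x) with hψ
  set V := potential L addr N x with hV
  have hV0 : 0 ≤ V := potential_nonneg x
  have htot : ∑ x', ‖ψ x'‖ ^ 2 = 1 := by rw [hψ, sum_norm_sq_orun, sum_norm_sq_ket]
  -- At `N` itself the round gives no bound on the trivial outcome, but there the potential is zero.
  have htriv : V * ∑ x' with ∀ b, x' (addr (t, b)) = false, ‖ψ x'‖ ^ 2 ≤ V * (1 / 2) := by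
    by_cases hN : N = L.subgroupAt fun p => x (addr p)
    · have : V = 0 := by rw [hV, potential, if_pos hN.symm]
      simp [this]
    · exact mul_le_mul_of_nonneg_left ((hr x hx).2 hN) hV0
  -- Every outcome is charged `V / 2`, and the trivial ones, of total probability at most `1 / 2`,
  -- another `V / 2`.
  calc ∑ x', potential L addr N x' * ‖ψ x'‖ ^ 2
      ≤ ∑ x', (V / 2 * ‖ψ x'‖ ^ 2 +
          if ∀ b, x' (addr (t, b)) = false then V / 2 * ‖ψ x'‖ ^ 2 else 0) := by
        refine Finset.sum_le_sum fun x' _ => ?_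
        by_cases h0 : ψ x' = 0
        · simp [h0]
        obtain ⟨-, h1, h2⟩ := hr.validAt haddr hx h0
        have hsq : 0 ≤ ‖ψ x'‖ ^ 2 := by positivity
        split_ifs with h
        · nlinarith
        · rw [add_zero]
          exact mul_le_mul_of_nonneg_right (h2 h) hsq
    _ = V / 2 * 1 + 1 / 2 * (V * ∑ x' with ∀ b, x' (addr (t, b)) = false, ‖ψ x'‖ ^ 2) := by
        rw [Finset.sum_add_distrib, ← Finset.mul_sum, htot, ← Finset.sum_filter, ← Finset.mul_sum]
        ring
    _ ≤ 3 / 4 * V := by linarith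

theorem orun_eq_sum (r : List (OGate W I O)) (ψ : State W) (x' : W → Bool) :
    orun F r ψ x' = ∑ x, ψ x * orun F r (ket x) x' := by
  classical
  have h : ψ = ∑ x, ψ x • ket x := by
    ext z
    simp [Finset.sum_apply, ket_apply]
  conv_lhs => rw [h, orun_sum_smul]
  simp [Finset.sum_apply]

/-- Each output configuration arises from only one valid input, so there is no interference and the
bound for basis states passes to superpositions as for a classical Markov chain. -/
theorem IsSamplingRound.step [N.Normal] (haddr : ∀ p, slot (addr p) = some p.1)
    {t : Fin T} {r : List (OGate W I O)} (hr : IsSamplingRound L F addr slot N t r)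
    {ψ : State W} (hψ : ∀ x, ψ x ≠ 0 → ValidAt L addr slot N t x) :
    (∀ x, orun F r ψ x ≠ 0 → ValidAt L addr slot N (t + 1) x) ∧
    ∑ x, potential L addr N x * ‖orun F r ψ x‖ ^ 2 ≤
      3 / 4 * ∑ x, potential L addr N x * ‖ψ x‖ ^ 2 := by
  -- Clearing the wires of slot `t` undoes the round on configurations, because they were zero
  -- before it.
  let π : (W → Bool) → W → Bool := fun x v => if slot v = some t then false else x v
  have hπ : ∀ x x', ψ x * orun F r (ket x) x' ≠ 0 → x = π x' := by
    intro x x' h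
    have hx := hψ x (left_ne_zero_of_mul h)
    obtain ⟨hoff, -⟩ := (hr x hx).1 x' (right_ne_zero_of_mul h)
    ext v
    by_cases hv : slot v = some t
    · simp only [π, if_pos hv]
      exact hx.clean v fun s hs => by rw [hv] at hs; cases hs; exact le_rfl
    · simp only [π, if_neg hv]
      exact (hoff v hv).symm
  refine ⟨fun x' h => ?_, ?_⟩
  · rw [orun_eq_sum] at h
    obtain ⟨x, -, hx⟩ := Finset.exists_ne_zero_of_sum_ne_zero h
    exact (hr.validAt haddr (hψ x (left_ne_zero_of_mul hx)) (right_ne_zero_of_mul hx)).1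
  have hnorm : ∀ x', ‖orun F r ψ x'‖ ^ 2 = ∑ x, ‖ψ x‖ ^ 2 * ‖orun F r (ket x) x'‖ ^ 2 := by
    intro x'
    have hz : ∀ x, x ≠ π x' → ψ x * orun F r (ket x) x' = 0 := fun x hx => by
      by_contra h; exact hx (hπ x x' h)
    rw [orun_eq_sum, Finset.sum_eq_single (π x') (fun x _ hx => hz x hx) (by simp),
      Finset.sum_eq_single (π x') _ (by simp), norm_mul, mul_pow]
    intro x _ hx
    rw [← mul_pow, ← norm_mul, hz x hx]
    simp
  calc ∑ x', potential L addr N x' * ‖orun F r ψ x'‖ ^ 2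
      = ∑ x, ‖ψ x‖ ^ 2 * ∑ x', potential L addr N x' * ‖orun F r (ket x) x'‖ ^ 2 := by
        simp_rw [hnorm, Finset.mul_sum]
        rw [Finset.sum_comm]
        exact Finset.sum_congr rfl fun x _ => Finset.sum_congr rfl fun x' _ => by ring
    _ ≤ ∑ x, ‖ψ x‖ ^ 2 * (3 / 4 * potential L addr N x) := by
        refine Finset.sum_le_sum fun x _ => ?_
        by_cases h0 : ψ x = 0
        · simp [h0]
        exact mul_le_mul_of_nonneg_left (hr.sum_potential_ket_le haddr (hψ x h0)) (by positivity)
    _ = 3 / 4 * ∑ x, potential L addr N x * ‖ψ x‖ ^ 2 := by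
        rw [Finset.mul_sum]
        exact Finset.sum_congr rfl fun x _ => by ring

theorem sampling_invariant [N.Normal] (haddr : ∀ p, slot (addr p) = some p.1)
    {r : Fin T → List (OGate W I O)} (hr : ∀ t, IsSamplingRound L F addr slot N t (r t))
    (t : ℕ) (ht : t ≤ T) :
    (∀ x, orun F (((List.finRange T).take t).flatMap r) (ket fun _ => false) x ≠ 0 →
      ValidAt L addr slot N t x) ∧
    ∑ x, potential L addr N x *
      ‖orun F (((List.finRange T).take t).flatMap r) (ket fun _ => false) x‖ ^ 2 ≤
      (3 / 4) ^ t * Nat.card G := by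
  classical
  induction t with
  | zero =>
    have h0 : ∀ x : W → Bool, orun F (((List.finRange T).take 0).flatMap r) (ket fun _ => false) x
        = if x = (fun _ => false) then 1 else 0 := fun x => ket_apply _ _
    refine ⟨fun x hx => ?_, ?_⟩
    · rw [h0] at hx
      obtain rfl : x = fun _ => false := by
        by_contra h; simp [h] at hx
      exact ⟨fun _ _ => rfl, L.isAddress_zero, by rw [L.subgroupAt_zero]; exact le_top⟩
    · rw [Finset.sum_eq_single (fun _ => false) (fun x _ hx => by rw [h0, if_neg hx]; simp)
        (by simp), h0, potential, L.subgroupAt_zero]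
      split_ifs <;> simp
  | succ t ih =>
    obtain ⟨ih1, ih2⟩ := ih (Nat.le_of_succ_le ht)
    have htake : (List.finRange T).take (t + 1) = (List.finRange T).take t ++ [⟨t, ht⟩] := by
      rw [List.take_succ_eq_append_getElem (by simpa using ht)]
      simp
    rw [htake, List.flatMap_append, List.flatMap_singleton]
    simp only [orun_append]
    obtain ⟨h1, h2⟩ := (hr ⟨t, ht⟩).step haddr ih1
    exact ⟨h1, h2.trans (by rw [pow_succ]; linarith)⟩

theorem one_sub_le_successProb_of_isSamplingRound [N.Normal]
    (haddr : ∀ p, slot (addr p) = some p.1)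
    {r : Fin T → List (OGate W I O)} (hr : ∀ t, IsSamplingRound L F addr slot N t (r t)) :
    1 - (3 / 4 : ℝ) ^ T * Nat.card G / 2 ≤
      successProb L addr N (orun F ((List.finRange T).flatMap r) (ket fun _ => false)) := by
  classical
  obtain ⟨h1, h2⟩ := sampling_invariant haddr hr T le_rfl
  rw [show (List.finRange T).take T = List.finRange T from
    List.take_of_length_le (by simp)] at h1 h2
  set ψ := orun F ((List.finRange T).flatMap r) (ket fun _ => false) with hψ
  have htot : ∑ x', ‖ψ x'‖ ^ 2 = 1 := by rw [hψ, sum_norm_sq_orun, sum_norm_sq_ket]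
  -- Markov's inequality with threshold `2`: a subgroup of order one that contains `N` equals `N`,
  -- so every other outcome has potential at least `2`.
  have h3 : 2 * (1 - successProb L addr N ψ) ≤ ∑ x, potential L addr N x * ‖ψ x‖ ^ 2 := by
    have hs : successProb L addr N ψ = ∑ x, if L.IsAddress (fun p => x (addr p)) ∧
        L.subgroupAt (fun p => x (addr p)) = N then ‖ψ x‖ ^ 2 else 0 := by
      unfold successProb
      congr!
    rw [← htot, hs, ← Finset.sum_sub_distrib, Finset.mul_sum]
    refine Finset.sum_le_sum fun x _ => ?_
    by_cases h0 : ψ x = 0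
    · simp [h0]
    have hv := h1 x h0
    by_cases hN : L.subgroupAt (fun p => x (addr p)) = N
    · rw [if_pos ⟨hv.isAddress, hN⟩, potential, if_pos hN]
      simp
    · rw [if_neg (fun h => hN h.2), potential, if_neg hN, sub_zero]
      refine mul_le_mul_of_nonneg_right ?_ (by positivity)
      have : 1 < Nat.card (L.subgroupAt fun p => x (addr p)) := by
        refine Nat.lt_of_le_of_ne Nat.card_pos fun h => hN ?_
        have hb := Subgroup.card_eq_one.1 h.symm
        exact le_antisymm (hb.le.trans bot_le) hv.le
      exact_mod_cast this
  linarith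

omit [Group G] [Finite G] in
-- Four rounds suffice for a halving since `(3/4)^4 < 1/2`. The division by `2` compensates for
-- rounding the logarithm down.
theorem pow_mul_card_div_two_le {k n : ℕ} (hn : n = Nat.log 2 (Nat.card G) + k) :
    (3 / 4 : ℝ) ^ (4 * n) * Nat.card G / 2 ≤ (1 / 2) ^ k := by
  have h1 : (Nat.card G : ℝ) ≤ 2 ^ (Nat.log 2 (Nat.card G)) * 2 := by
    exact_mod_cast (Nat.lt_pow_succ_log_self one_lt_two (Nat.card G)).le
  have h2 : (3 / 4 : ℝ) ^ (4 * n) ≤ (1 / 2) ^ n := by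
    rw [pow_mul]
    exact pow_le_pow_left₀ (by norm_num) (by norm_num) n
  calc (3 / 4 : ℝ) ^ (4 * n) * Nat.card G / 2
      ≤ (1 / 2) ^ n * (2 ^ (Nat.log 2 (Nat.card G)) * 2) / 2 := by gcongr
    _ = (1 / 2) ^ k := by
      rw [hn, pow_add]
      have : (1 / 2 : ℝ) ^ (Nat.log 2 (Nat.card G)) * 2 ^ (Nat.log 2 (Nat.card G)) = 1 := by
        rw [← mul_pow]; norm_num
      linear_combination (1 / 2 : ℝ) ^ k * this

end Chain

/-! ### Rounds of Fourier sampling -/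

theorem IrrLabels.finite_irr {G : Type*} [Group G] {m : ℕ} (L : IrrLabels G m) (K : Subgroup G)
    [hK : K.Normal] : Finite (Irr K) :=
  Finite.of_injective _ (L.label_injective K hK)

theorem exists_of_sum_smul_ket_ne_zero {W ι : Type*} {s : Finset ι} {α : ι → ℂ}
    {Z : ι → W → Bool} {x : W → Bool} (h : (∑ i ∈ s, α i • ket (Z i)) x ≠ 0) :
    ∃ i, x = Z i ∧ α i ≠ 0 := by
  classical
  rw [Finset.sum_apply] at h
  obtain ⟨i, -, hi⟩ := Finset.exists_ne_zero_of_sum_ne_zero h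
  simp only [Pi.smul_apply, ket_apply, smul_eq_mul] at hi
  refine ⟨i, ?_, left_ne_zero_of_mul hi⟩
  by_contra hx
  simp [hx] at hi

theorem sum_filter_norm_sq_sum_smul_ket {W ι : Type*} [Fintype W] [DecidableEq W] [Fintype ι]
    {α : ι → ℂ} {Z : ι → W → Bool} (hZ : Function.Injective Z) (P : (W → Bool) → Prop)
    [DecidablePred P] :
    ∑ x with P x, ‖(∑ i, α i • ket (Z i)) x‖ ^ 2 = ∑ i with P (Z i), ‖α i‖ ^ 2 := by
  classical
  have hval : ∀ i, (∑ j, α j • ket (Z j)) (Z i) = α i := by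
    intro i
    rw [Finset.sum_apply, Finset.sum_eq_single i]
    · simp
    · intro j _ hj
      simp [ket_apply, hZ.ne hj.symm]
    · simp
  refine (Finset.sum_of_injOn Z hZ.injOn ?_ ?_ ?_).symm
  · intro i hi; simpa using hi
  · intro x hx hx'
    have : (∑ i, α i • ket (Z i)) x = 0 := by
      by_contra h
      obtain ⟨i, rfl, -⟩ := exists_of_sum_smul_ket_ne_zero h
      exact hx' ⟨i, by simpa using hx, rfl⟩
    rw [this]; simp
  · intro i _
    rw [hval]

section Expansion

variable {G : Type*} [Group G] {m T : ℕ} {L : IrrLabels G m} {W I O : Type*}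
  [Fintype W] [DecidableEq W] {F : (I → Bool) → O → Bool}
  {addr : Fin T × Fin m → W} {slot : W → Option (Fin T)} {N : Subgroup G}

/-- A round is a sampling round if its outcome has an expansion in the labels of characters
(with further labels) and the values of an oracle. -/
theorem sampling_of_expansion (t : Fin T) (x : W → Bool) (K : Subgroup G) [K.Normal]
    {Ω Λ : Type*} [Fintype Ω] [Fintype Λ] (μ : Ω → Irr K) [DecidablePred fun ω => μ ω = 1]
    (α : Ω → Λ → ℂ) (Z : Ω → Λ → W → Bool)
    {ψ : State W} (hψ : ψ = ∑ ω, ∑ y, α ω y • ket (Z ω y))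
    (hZ : ∀ ω y ω' y', Z ω y = Z ω' y' → ω = ω' ∧ y = y')
    (hoff : ∀ ω y v, slot v ≠ some t → Z ω y v = x v)
    (hlab : ∀ ω y b, Z ω y (addr (t, b)) = L.label K (μ ω) b)
    (hker : ∀ ω y, α ω y ≠ 0 → N.subgroupOf K ≤ (μ ω).ker)
    (hone : N ≠ K → ∑ ω with μ ω = 1, ∑ y, ‖α ω y‖ ^ 2 ≤ 1 / 2) :
    (∀ x', ψ x' ≠ 0 → (∀ v, slot v ≠ some t → x' v = x v) ∧
      ∃ μ : Irr K, N.subgroupOf _ ≤ μ.ker ∧ ∀ b, x' (addr (t, b)) = L.label _ μ b) ∧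
    (N ≠ K → ∑ x' with ∀ b, x' (addr (t, b)) = false, ‖ψ x'‖ ^ 2 ≤ 1 / 2) := by
  have hψ' : ψ = ∑ p : Ω × Λ, α p.1 p.2 • ket (Z p.1 p.2) := by
    rw [hψ, Fintype.sum_prod_type]
  subst hψ'
  constructor
  · intro x' h
    obtain ⟨⟨ω, y⟩, rfl, hα⟩ := exists_of_sum_smul_ket_ne_zero h
    exact ⟨hoff ω y, μ ω, hker ω y hα, hlab ω y⟩
  · intro hN
    have hinj : Function.Injective fun p : Ω × Λ => Z p.1 p.2 := fun p q h =>
      Prod.ext (hZ _ _ _ _ h).1 (hZ _ _ _ _ h).2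
    rw [sum_filter_norm_sq_sum_smul_ket hinj]
    refine le_trans (le_of_eq ?_) (hone hN)
    rw [Finset.sum_filter, Fintype.sum_prod_type, Finset.sum_filter]
    refine Finset.sum_congr rfl fun ω _ => ?_
    -- The zero string is the label of the trivial character and of no other.
    have hiff : ∀ y, (∀ b, Z ω y (addr (t, b)) = false) ↔ μ ω = 1 := by
      intro y
      simp only [hlab]
      constructor
      · intro h
        refine L.label_injective K inferInstance ?_
        rw [L.label_one]
        exact funext h
      · intro h b
        rw [h, L.label_one]
    simp only [hiff]
    split_ifs <;> simp

end Expansion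

/-- Replace the entries of slot `t`. -/
def updSlot {T m : ℕ} (t : Fin T) (a : Fin T × Fin m → Bool) (y : Fin m → Bool) :
    Fin T × Fin m → Bool := fun p => if p.1 = t then y p.2 else a p

theorem updSlot_self {T m : ℕ} (t : Fin T) (a : Fin T × Fin m → Bool) (y : Fin m → Bool)
    (b : Fin m) : updSlot t a y (t, b) = y b := if_pos rfl

theorem updSlot_of_ne {T m : ℕ} {t : Fin T} (a : Fin T × Fin m → Bool) (y : Fin m → Bool)
    {p : Fin T × Fin m} (h : p.1 ≠ t) : updSlot t a y p = a p := if_neg h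

theorem updSlot_injective {T m : ℕ} (t : Fin T) (a : Fin T × Fin m → Bool) :
    Function.Injective (updSlot t a) := fun y y' h => by
  ext b
  rw [← updSlot_self t a y b, h, updSlot_self]

theorem extend_inl {A B : Type*} (u u' : A → Bool) (v : B → Bool) :
    Function.extend (Function.Embedding.inl : A ↪ A ⊕ B) u (Sum.elim u' v) = Sum.elim u v := by
  ext (i | j)
  · exact (Function.Embedding.inl : A ↪ A ⊕ B).injective.extend_apply u _ i
  · exact Function.extend_apply' _ _ _ (by simp)

theorem orun_lift_inl_ket {A B I O ι : Type*} [DecidableEq A] [DecidableEq B]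
    (F : (I → Bool) → O → Bool) (c : List (Gate A)) (u : A → Bool) (v : B → Bool) (s : Finset ι)
    (α : ι → ℂ) (z : ι → A → Bool) (h : run c (ket u) = ∑ i ∈ s, α i • ket (z i)) :
    orun F (liftCircuit (Function.Embedding.inl : A ↪ A ⊕ B) c) (ket (Sum.elim u v)) =
      ∑ i ∈ s, α i • ket (Sum.elim (z i) v) := by
  rw [orun_liftCircuit_ket F _ c _ s α z (by
    rw [← h]; rfl)]
  simp only [extend_inl]

theorem run_inverse_ket {W ι : Type*} [DecidableEq W] {c : List (Gate W)} {s : Finset ι}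
    {α : ι → ℂ} {z : ι → W → Bool} {u : W → Bool}
    (h : ∑ i ∈ s, α i • run c (ket (z i)) = ket u) :
    run (inverse c) (ket u) = ∑ i ∈ s, α i • ket (z i) := by
  rw [← h, ← run_sum_smul, run_inverse]

/-! ### One round of recursive AKR sampling. -/

section AKRRound

variable {G : Type*} [Group G] [Finite G] {m T ℓ w : ℕ}

/-- Orthogonality to the trivial character is AKR sampling with a constant oracle, whose level set
is invariant under the whole group. -/
theorem sum_qftEntry_mul_conj_one [Fintype (ConjClasses G)] (μ : Irr G) [Decidable (μ = 1)] :
    ∑ C, μ.qftEntry C * conj ((1 : Irr G).qftEntry C) = if μ = 1 then 1 else 0 := by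
  classical
  have := Fintype.ofFinite G
  have h : ∑ C, μ.qftEntry C * conj ((1 : Irr G).qftEntry C) =
      akrAmp (fun _ : ConjClasses G => ()) μ () := by
    simp [akrAmp, finsum_eq_sum_of_fintype]
  rw [h]
  split_ifs with h1
  · subst h1
    rw [akrAmp_one]
    simp [Fintype.card_ne_zero]
  · rw [akrAmp_eq, μ.sum_filter_char ⊤ (fun hle => h1 (μ.eq_one_of_ker_eq_top (top_le_iff.1 hle)))
      _ (by simp), mul_zero]

omit [Finite G] in
-- Classes with the same oracle value lead to the same final configuration, so their amplitudes add
-- up to `akrAmp`.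
theorem sum_fiberwise_akrAmp {Λ : Type*} [Fintype Λ] [Fintype (ConjClasses G)] {M : Type*}
    [AddCommGroup M] [Module ℂ M] (f : ConjClasses G → Λ) (μ : Irr G) (Z : Λ → M) :
    ∑ C, (conj ((1 : Irr G).qftEntry C) * μ.qftEntry C) • Z (f C) =
      ∑ y, akrAmp f μ y • Z y := by
  classical
  rw [← Finset.sum_fiberwise Finset.univ f]
  refine Finset.sum_congr rfl fun y _ => ?_
  rw [akrAmp, finsum_eq_sum_of_fintype]
  simp only [finsum_eq_if]
  rw [← Finset.sum_filter, Finset.sum_smul]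
  refine Finset.sum_congr rfl fun C hC => ?_
  rw [(Finset.mem_filter.1 hC).2, mul_comm]

/-- The wires that are used in a given round. -/
def algSlot : AlgWires T m ℓ w → Option (Fin T) :=
  Sum.elim (Sum.elim (fun p => some p.1) fun _ => none) fun p => some p.1

theorem queryMap_queryWires (F : ((Fin T × Fin m) ⊕ Fin m → Bool) → Fin ℓ → Bool) (t : Fin T)
    (a : Fin T × Fin m → Bool) (b : Fin m → Bool) (y : Fin T × Fin ℓ → Bool)
    (hy : ∀ o, y (t, o) = false) :
    queryMap F (queryWires t) (Sum.elim (pack (w := w) a b) y) =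
      Sum.elim (pack a b) (updSlot t y (F (Sum.elim a b))) := by
  ext v
  by_cases hv : ∃ o, (queryWires t : _ ↪ AlgWires T m ℓ w) (Sum.inr o) = v
  · obtain ⟨o, rfl⟩ := hv
    rw [queryMap_inr]
    have h1 : (fun i => Sum.elim (pack (w := w) a b) y (queryWires t (Sum.inl i))) =
        Sum.elim a b := by
      ext (i | i) <;> rfl
    rw [h1]
    change xor (y (t, o)) _ = updSlot t y _ (t, o)
    rw [hy, updSlot_self]
    simp
  · push Not at hv
    rw [queryMap_of_forall_ne _ _ _ _ hv]
    rcases v with v | ⟨s, o⟩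
    · rfl
    · have : s ≠ t := by rintro rfl; exact hv o rfl
      exact (updSlot_of_ne y _ this).symm

theorem orun_akr_swaps (F : ((Fin T × Fin m) ⊕ Fin m → Bool) → Fin ℓ → Bool) (t : Fin T)
    (a : Fin T × Fin m → Bool) (b : Fin m → Bool) (y : Fin T × Fin ℓ → Bool)
    (ha : ∀ o, a (t, o) = false) :
    orun F ((List.finRange m).map fun b =>
      (OGate.gate (Gate.two (Sum.inl (Sum.inr (Sum.inl b))) (Sum.inl (Sum.inl (t, b))) (by simp)
      Gate.swapMatrix) : OGate (AlgWires T m ℓ w) _ _)) (ket (Sum.elim (pack a b) y)) =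
      ket (Sum.elim (pack (updSlot t a b) fun _ => false) y) := by
  refine orun_swaps F (fun b => Sum.inl (Sum.inr (Sum.inl b))) (fun b => Sum.inl (Sum.inl (t, b)))
    (fun _ _ h => by simpa using h) (fun _ _ h => by simpa using h) (by simp) _
    (List.nodup_finRange m) _ _ ?_ ?_ ?_
  · intro i _
    exact (ha i).symm
  · intro i _
    exact updSlot_self t a b i
  · rintro ((⟨s, i⟩ | i | i) | p) hx
    · refine updSlot_of_ne a b ?_
      rintro rfl
      exact (hx i (List.mem_finRange i)).2 rfl
    · exact absurd rfl (hx i (List.mem_finRange i)).1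
    · rfl
    · rfl

theorem isSamplingRound_akrRound {L : IrrLabels G m}
    {cls : ∀ K : Subgroup G, ConjClasses K → Fin m → Bool}
    {c : List (Gate (RegWires (Fin T × Fin m) (Fin m) w))} {N : Subgroup G} [N.Normal]
    (hc : ComputesClassQFT L cls N c) {f : ∀ K : Subgroup G, ConjClasses K → Fin ℓ → Bool}
    (hf : ∀ K : Subgroup G, K.Normal → N ≤ K → Hides (f K) (subhyp (N.subgroupOf K)))
    {F : ((Fin T × Fin m) ⊕ Fin m → Bool) → Fin ℓ → Bool}
    (hF : ∀ a : Fin T × Fin m → Bool, L.IsAddress a → N ≤ L.subgroupAt a →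
      ∀ C : ConjClasses (L.subgroupAt a), F (Sum.elim a (cls _ C)) = f _ C) (t : Fin T) :
    IsSamplingRound L F (fun i => Sum.inl (Sum.inl i)) algSlot N t (akrRound c t) := by
  classical
  intro x hx
  obtain ⟨hclean, haddr, hle⟩ := hx
  set a : Fin T × Fin m → Bool := fun p => x (Sum.inl (Sum.inl p)) with ha
  set y : Fin T × Fin ℓ → Bool := fun p => x (Sum.inr p) with hy
  have ha0 : ∀ b, a (t, b) = false := fun b => hclean _ fun s hs => by
    simp only [algSlot, Sum.elim_inl, Option.some.injEq] at hs; rw [hs]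
  have hy0 : ∀ b, y (t, b) = false := fun b => hclean _ fun s hs => by
    simp only [algSlot, Sum.elim_inr, Option.some.injEq] at hs; rw [hs]
  have hxeq : x = Sum.elim (pack a fun _ => false) y := by
    ext ((p | i | i) | p)
    · rfl
    · exact hclean _ fun s hs => by simp [algSlot] at hs
    · exact hclean _ fun s hs => by simp [algSlot] at hs
    · rfl
  set K := L.subgroupAt a with hK
  have hKn : K.Normal := L.subgroupAt_normal a
  have := L.finite_irr K
  have := Fintype.ofFinite (Irr K)
  have := Fintype.ofFinite (ConjClasses K)
  have hide := hf K hKn hle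
  have hrun : ∀ C : ConjClasses K, run c (ket (pack a (cls K C))) =
      ∑ μ : Irr K, μ.qftEntry C • ket (pack a (L.label K μ)) := by
    intro C
    rw [hc a haddr hle C]
    ext z
    rw [finsum_eq_sum_of_fintype]
    simp only [Finset.sum_apply, Pi.smul_apply, smul_eq_mul]
    rfl
  -- Only the forward action on class labels is given. The inverse is found by exhibiting a
  -- superposition of classes that `c` sends to the zero label; orthogonality to the trivial
  -- character is all that this needs.
  have hinv : run (inverse c) (ket (pack a fun _ => false)) =
      ∑ C : ConjClasses K, conj ((1 : Irr K).qftEntry C) • ket (pack a (cls K C)) := by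
    refine run_inverse_ket ?_
    simp only [hrun, Finset.smul_sum, smul_smul]
    rw [Finset.sum_comm]
    simp only [← Finset.sum_smul]
    rw [Finset.sum_eq_single 1]
    · simp only [mul_comm (conj _), sum_qftEntry_mul_conj_one, L.label_one]
      simp
    · intro μ _ hμ
      simp only [mul_comm (conj _), sum_qftEntry_mul_conj_one, if_neg hμ, zero_smul]
    · simp
  refine sampling_of_expansion (L := L) (addr := fun i => Sum.inl (Sum.inl i)) (slot := algSlot)
    (N := N) t x K (fun μ : Irr K => μ) (akrAmp (f K))
    (fun μ v => Sum.elim (pack (updSlot t a (L.label K μ)) fun _ => false) (updSlot t y v))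
    ?_ ?_ ?_ ?_ ?_ ?_
  · rw [akrRound, orun_append, orun_append, orun_append, hxeq,
      orun_lift_inl_ket F _ _ y _ _ _ hinv, orun_sum_smul, orun_sum_smul, orun_sum_smul]
    -- Each class is followed separately: its oracle value and the sampled label end up in registers
    -- that were empty, and the work register returns to zero.
    have hstep : ∀ C : ConjClasses K, orun F ((List.finRange m).map fun b =>
        OGate.gate (Gate.two (Sum.inl (Sum.inr (Sum.inl b))) (Sum.inl (Sum.inl (t, b))) (by simp)
        Gate.swapMatrix)) (orun F (liftCircuit Function.Embedding.inl c)
          (orun F [OGate.query (queryWires t)] (ket (Sum.elim (pack a (cls K C)) y)))) =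
        ∑ μ : Irr K, μ.qftEntry C • ket (Sum.elim (pack (w := w) (updSlot t a (L.label K μ))
          fun _ => false) (updSlot t y (f K C))) := by
      intro C
      have hq : orun F [OGate.query (queryWires t)] (ket (Sum.elim (pack (w := w) a (cls K C)) y)) =
          ket (Sum.elim (pack a (cls K C)) (updSlot t y (f K C))) := by
        change (OGate.query (queryWires t)).apply F (ket _) = _
        rw [query_apply_ket, queryMap_queryWires F t a _ y hy0, hF a haddr hle C]
      rw [hq, orun_lift_inl_ket F _ _ _ _ _ _ (hrun C), orun_sum_smul]
      simp only [orun_akr_swaps F t a _ _ ha0]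
    simp only [hstep, Finset.smul_sum, smul_smul]
    rw [Finset.sum_comm]
    exact Finset.sum_congr rfl fun μ _ => sum_fiberwise_akrAmp (f K) μ fun v =>
      ket (Sum.elim (pack (updSlot t a (L.label K μ)) fun _ => false) (updSlot t y v))
  · intro μ v μ' v' h
    constructor
    · refine L.label_injective K hKn (updSlot_injective t a (funext fun p => ?_))
      exact congrFun h (Sum.inl (Sum.inl p))
    · refine updSlot_injective t y (funext fun p => ?_)
      exact congrFun h (Sum.inr p)
  · intro μ v z hz
    rw [hxeq]
    rcases z with (p | i | i) | p
    · exact updSlot_of_ne a _ fun h => hz (congrArg some h)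
    · rfl
    · rfl
    · exact updSlot_of_ne y _ fun h => hz (congrArg some h)
  · intro μ v b
    exact updSlot_self t a _ b
  · intro μ v h
    exact le_ker_of_akrAmp_ne_zero hide h
  · intro hN
    rw [Finset.filter_eq' Finset.univ (1 : Irr K), if_pos (Finset.mem_univ _),
      Finset.sum_singleton]
    refine sum_norm_akrAmp_one_sq_le (fun h => hN ?_) hide _
    exact le_antisymm hle (Subgroup.subgroupOf_eq_top.1 h)

end AKRRound

/-! ### Sums of matrix representations -/

namespace IrrMatrices

variable {G : Type*} [Group G] (R : IrrMatrices G) (μ : Irr G)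

/-- The matrix representation as a homomorphism into the ring of matrices. -/
def hom : G →* Matrix (Fin (R.dim μ)) (Fin (R.dim μ)) ℂ :=
  (Submonoid.subtype _).comp (R.mat μ)

theorem hom_apply (g : G) : R.hom μ g = (R.mat μ g).1 := rfl

theorem conjTranspose_hom (g : G) : (R.hom μ g).conjTranspose = R.hom μ g⁻¹ := by
  rw [hom_apply, hom_apply, map_inv]
  rfl

theorem dim_one : R.dim 1 = 1 := by
  have h := R.trace_mat 1 1
  rw [map_one, Matrix.UnitaryGroup.one_val, Matrix.trace_one, Irr.one_char, Fintype.card_fin] at h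
  exact_mod_cast h

instance : Subsingleton (Fin (R.dim 1)) := by
  rw [R.dim_one]; infer_instance

theorem hom_one_apply (g : G) (i j : Fin (R.dim 1)) : R.hom 1 g i j = 1 := by
  have h := R.trace_mat 1 g
  rw [Irr.one_char, Matrix.trace, Finset.sum_eq_single i (fun k _ hk =>
    absurd (Subsingleton.elim k i) hk) (by simp)] at h
  rwa [Subsingleton.elim j i]

open scoped ComplexOrder in
-- Only the traces tie these matrices to `μ`, so irreducibility is not invoked for them. The sum `S`
-- over `N` satisfies `Sᴴ * S = |N| S` by unitarity and has trace zero by the character sum; hence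
-- `Sᴴ * S` has trace zero and `S = 0`.
theorem sum_hom_subgroup (N : Subgroup G) [N.Normal] [Fintype N] (hN : ¬ N ≤ μ.ker) :
    ∑ n : N, R.hom μ n = 0 := by
  have htr : Matrix.trace (∑ n : N, R.hom μ n) = 0 := by
    rw [Matrix.trace_sum, ← μ.sum_char_subgroup N hN]
    exact Finset.sum_congr rfl fun n _ => R.trace_mat μ n
  have hmul : (∑ n : N, R.hom μ n).conjTranspose * ∑ n : N, R.hom μ n =
      (Fintype.card N : ℂ) • ∑ n : N, R.hom μ n := by
    have hn : ∀ n : N, (R.hom μ n).conjTranspose * ∑ n : N, R.hom μ n = ∑ n : N, R.hom μ n := by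
      intro n
      rw [conjTranspose_hom, Finset.mul_sum]
      exact Fintype.sum_equiv (Equiv.mulLeft n⁻¹) _ _ fun k => by simp
    rw [Matrix.conjTranspose_sum, Finset.sum_mul]
    simp only [hn]
    rw [Finset.sum_const, Nat.cast_smul_eq_nsmul]
    rfl
  rw [← Matrix.trace_conjTranspose_mul_self_eq_zero_iff, hmul, Matrix.trace_smul, htr, smul_zero]

theorem sum_filter_hom [Fintype G] (N : Subgroup G) [N.Normal] (hN : ¬ N ≤ μ.ker)
    (φ : G → Prop) [DecidablePred φ] (hφ : ∀ g, ∀ n ∈ N, φ (g * n) ↔ φ g) :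
    ∑ g with φ g, R.hom μ g = 0 := by
  classical
  exact sum_filter_eq_zero_of_sum_subgroup (R.hom μ) N (R.sum_hom_subgroup μ N hN) φ hφ

theorem sum_filter_hom_apply [Fintype G] (N : Subgroup G) [N.Normal] (hN : ¬ N ≤ μ.ker)
    (φ : G → Prop) [DecidablePred φ] (hφ : ∀ g, ∀ n ∈ N, φ (g * n) ↔ φ g)
    (i j : Fin (R.dim μ)) : ∑ g with φ g, R.hom μ g i j = 0 := by
  rw [← Matrix.sum_apply, R.sum_filter_hom μ N hN φ hφ]
  rfl

/-- The index set of the matrix entries of the irreducible representations. -/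
abbrev Entry := Σ μ : Irr G, Fin (R.dim μ) × Fin (R.dim μ)

/-- The entries of the Fourier transform of the group. -/
def qftEntry (s : R.Entry) (g : G) : ℂ :=
  (Real.sqrt (R.dim s.1 / Nat.card G) : ℂ) * R.hom s.1 g s.2.1 s.2.2

/-- The amplitude at a matrix entry and an oracle value after Fourier sampling with the oracle
`φ`. -/
def samplingAmp {Λ : Type*} (φ : G → Λ) (s : R.Entry) (y : Λ) : ℂ :=
  ∑ᶠ (g : G) (_ : φ g = y), (Real.sqrt (1 / Nat.card G) : ℂ) * R.qftEntry s g

variable {Λ : Type*} (φ : G → Λ)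

theorem samplingAmp_eq [Fintype G] (s : R.Entry) (y : Λ) [DecidablePred fun g => φ g = y] :
    R.samplingAmp φ s y = (Real.sqrt (1 / Nat.card G) : ℂ) *
      (Real.sqrt (R.dim s.1 / Nat.card G) : ℂ) * ∑ g with φ g = y, R.hom s.1 g s.2.1 s.2.2 := by
  classical
  rw [samplingAmp, finsum_eq_sum_of_fintype, Finset.mul_sum, Finset.sum_filter]
  refine Finset.sum_congr rfl fun g _ => ?_
  rw [finsum_eq_if, qftEntry, mul_assoc]

theorem samplingAmp_one [Fintype G] (s : R.Entry) (hs : s.1 = 1) (y : Λ)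
    [DecidablePred fun g => φ g = y] : R.samplingAmp φ s y =
      (((Finset.univ.filter fun g => φ g = y).card : ℝ) / Nat.card G : ℝ) := by
  obtain ⟨μ, i, j⟩ := s
  obtain rfl : μ = 1 := hs
  rw [samplingAmp_eq]
  simp only [hom_one_apply, dim_one, Nat.cast_one]
  rw [← Complex.ofReal_mul, Real.mul_self_sqrt (by positivity)]
  simp [div_eq_inv_mul]

theorem le_ker_of_samplingAmp_ne_zero [Finite G] {N : Subgroup G} [N.Normal] (hφ : ConjSep N φ)
    {s : R.Entry} {y : Λ} (h : R.samplingAmp φ s y ≠ 0) : N ≤ s.1.ker := by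
  classical
  have := Fintype.ofFinite G
  by_contra hN
  rw [samplingAmp_eq, R.sum_filter_hom_apply s.1 N hN _ (hφ.mul_mem y), mul_zero] at h
  exact h rfl

theorem sum_samplingAmp_one_sq_le [Finite G] [Fintype R.Entry] [Fintype Λ] {N : Subgroup G}
    [N.Normal] (hN : N ≠ ⊤) (hφ : ConjSep N φ) [DecidablePred fun s : R.Entry => s.1 = 1] :
    ∑ s : R.Entry with s.1 = 1, ∑ y, ‖R.samplingAmp φ s y‖ ^ 2 ≤ 1 / 2 := by
  classical
  have := Fintype.ofFinite G
  have hsq := hφ.sum_sq_le hN Finset.univ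
  have hz : 0 < R.dim 1 := by rw [R.dim_one]; exact one_pos
  -- The trivial representation has a single matrix entry, so the collision bound for the oracle
  -- applies unchanged.
  rw [Finset.sum_eq_single ⟨1, ⟨0, hz⟩, ⟨0, hz⟩⟩]
  · refine le_trans (le_of_eq (Finset.sum_congr rfl fun y _ => ?_)) hsq
    rw [samplingAmp_one R φ _ rfl, Complex.norm_real, Real.norm_eq_abs, sq_abs]
  · rintro ⟨μ, i, j⟩ hs hne
    obtain rfl : μ = 1 := (Finset.mem_filter.1 hs).2
    refine absurd ?_ hne
    congr 2 <;> exact Subsingleton.elim _ _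
  · intro h
    simp at h

theorem sum_qftEntry [Fintype G] (s : R.Entry) [Decidable (s.1 = 1)] :
    ∑ g, (Real.sqrt (1 / Nat.card G) : ℂ) * R.qftEntry s g = if s.1 = 1 then 1 else 0 := by
  classical
  have h : ∑ g, (Real.sqrt (1 / Nat.card G) : ℂ) * R.qftEntry s g =
      R.samplingAmp (fun _ => ()) s () := by
    simp [samplingAmp, finsum_eq_sum_of_fintype]
  rw [h]
  split_ifs with h1
  · rw [samplingAmp_one R _ _ h1]
    simp [Fintype.card_ne_zero]
  · rw [samplingAmp_eq, R.sum_filter_hom_apply s.1 ⊤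
      (fun hle => h1 (s.1.eq_one_of_ker_eq_top (top_le_iff.1 hle))) _ (by simp), mul_zero]

theorem sum_fiberwise_samplingAmp [Fintype G] [Fintype Λ] {M : Type*} [AddCommGroup M]
    [Module ℂ M] (s : R.Entry) (Z : Λ → M) :
    ∑ g, ((Real.sqrt (1 / Nat.card G) : ℂ) * R.qftEntry s g) • Z (φ g) =
      ∑ y, R.samplingAmp φ s y • Z y := by
  classical
  rw [← Finset.sum_fiberwise Finset.univ φ]
  refine Finset.sum_congr rfl fun y _ => ?_
  rw [samplingAmp, finsum_eq_sum_of_fintype]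
  simp only [finsum_eq_if]
  rw [← Finset.sum_filter, Finset.sum_smul]
  refine Finset.sum_congr rfl fun g hg => ?_
  rw [(Finset.mem_filter.1 hg).2]

end IrrMatrices

/-! ### Rounds of sampling with a homomorphic oracle -/

section HomRound

variable {G H : Type*} [Group G] [Group H] {m r T ℓ w ℓ' w' : ℕ}

/-- The class in the image of `K` of the value of `f`. -/
def imageClass (f : G →* H) (K : Subgroup G) (g : K) : ConjClasses (K.map f) :=
  ConjClasses.mk ⟨f g, Subgroup.mem_map_of_mem f g.2⟩

/-- `f` induces an isomorphism of `K ⧸ (N ∩ K)` with `f(K)`, and so a bijection of their classes.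
Classes must be taken in `f(K)`, so that conjugating elements lift to `K`. -/
theorem conjSep_imageClass {Λ : Type*} {f : G →* H} {N : Subgroup G} [N.Normal]
    (hf : ∀ x x' : G, f x = f x' ↔ ∃ y ∈ N, x' = x * y) (K : Subgroup G)
    {h : ConjClasses (K.map f) → Λ} (hh : Function.Injective h) :
    ConjSep (N.subgroupOf K) fun g => h (imageClass f K g) := by
  intro g g'
  rw [hh.eq_iff, imageClass, imageClass, ConjClasses.mk_eq_mk_iff_isConj]
  have hq : ∀ a b : K, (a : K ⧸ N.subgroupOf K) = b ↔ f a = f b := by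
    intro a b
    rw [QuotientGroup.eq, Subgroup.mem_subgroupOf, hf]
    constructor
    · intro h
      exact ⟨_, h, by simp⟩
    · rintro ⟨y, hy, h⟩
      simpa [h] using hy
  constructor
  · intro hc
    obtain ⟨⟨_, k, hk, rfl⟩, hc⟩ := isConj_iff.1 hc
    have hc' : f k * f g * (f k)⁻¹ = f g' := congrArg Subtype.val hc
    refine isConj_iff.2 ⟨((⟨k, hk⟩ : K) : K ⧸ N.subgroupOf K), ?_⟩
    have := (hq (⟨k, hk⟩ * g * ⟨k, hk⟩⁻¹) g').2 (by simpa using hc')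
    simpa using this
  · intro hc
    obtain ⟨k, hk⟩ := isConj_iff.1 hc
    obtain ⟨k, rfl⟩ := QuotientGroup.mk_surjective k
    have := (hq (k * g * k⁻¹) g').1 (by simpa using hk)
    exact isConj_iff.2 ⟨⟨f k, Subgroup.mem_map_of_mem f k.2⟩, Subtype.ext (by simpa using this)⟩

/-- The contents of all registers: address, work register, value of `f`, classes, and discarded
matrix indices; the ancillas are zero. -/
def homPack (a : Fin T × Fin m → Bool) (b : Fin m ⊕ Fin r → Bool) (h : Fin ℓ → Bool)
    (y : Fin T × Fin ℓ' → Bool) (z : Fin T × Fin r → Bool) : HomWires T m r ℓ ℓ' w w' → Bool :=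
  Sum.elim (pack a b) (Sum.elim h (Sum.elim y (Sum.elim (fun _ => false) z)))

theorem queryMap_homQueryWires (F : (Fin m ⊕ Fin r → Bool) → Fin ℓ → Bool)
    (a : Fin T × Fin m → Bool) (b : Fin m ⊕ Fin r → Bool) (h : Fin ℓ → Bool)
    (y : Fin T × Fin ℓ' → Bool) (z : Fin T × Fin r → Bool) :
    queryMap F homQueryWires (homPack (w := w) (w' := w') a b h y z) =
      homPack a b (fun o => xor (h o) (F b o)) y z := by
  ext v
  by_cases hv : ∃ o, (homQueryWires : _ ↪ HomWires T m r ℓ ℓ' w w') (Sum.inr o) = v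
  · obtain ⟨o, rfl⟩ := hv
    rw [queryMap_inr]
    rfl
  · push Not at hv
    rw [queryMap_of_forall_ne _ _ _ _ hv]
    rcases v with v | v | v
    · rfl
    · exact absurd rfl (hv v)
    · rfl

theorem homPack_comp_homClassWires (t : Fin T) (a : Fin T × Fin m → Bool)
    (b : Fin m ⊕ Fin r → Bool) (h : Fin ℓ → Bool) (y : Fin T × Fin ℓ' → Bool)
    (z : Fin T × Fin r → Bool) :
    homPack (w := w) a b h y z ∘ homClassWires t =
      pack (w := w') a (Sum.elim h fun o => y (t, o)) := by
  ext (p | (o | o) | o) <;> rfl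

theorem extend_homClassWires (t : Fin T) (a : Fin T × Fin m → Bool)
    (b : Fin m ⊕ Fin r → Bool) (h : Fin ℓ → Bool) (y : Fin T × Fin ℓ' → Bool)
    (z : Fin T × Fin r → Bool) (u : Fin ℓ' → Bool) :
    Function.extend (homClassWires t) (pack (w := w') a (Sum.elim h u))
      (homPack (w := w) a b h y z) = homPack a b h (updSlot t y u) z := by
  have happ := (homClassWires t : _ ↪ HomWires T m r ℓ ℓ' w w').injective.extend_apply
    (pack (w := w') a (Sum.elim h u)) (homPack (w := w) a b h y z)
  have happ' := fun v => Function.extend_apply' (f := (homClassWires t : _ ↪ HomWires T m r ℓ ℓ' w w'))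
    (pack (w := w') a (Sum.elim h u)) (homPack (w := w) a b h y z) v
  ext ((p | v) | v | ⟨s, o⟩ | v | p)
  · exact happ (Sum.inl p)
  · exact happ' _ (by rintro ⟨(_ | (_ | _) | _), h⟩ <;> cases h)
  · exact happ (Sum.inr (Sum.inl (Sum.inl v)))
  · by_cases hs : s = t
    · subst hs
      exact (happ (Sum.inr (Sum.inl (Sum.inr o)))).trans (updSlot_self s y u o).symm
    · refine (happ' _ ?_).trans (updSlot_of_ne y u hs).symm
      rintro ⟨(_ | (_ | _) | _), h⟩ <;> cases h
      exact hs rfl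
  · exact happ (Sum.inr (Sum.inr v))
  · exact happ' _ (by rintro ⟨(_ | (_ | _) | _), h⟩ <;> cases h)

/-- Swapping with empty registers moves the contents: the label goes to the address and the matrix
indices to a register that is not touched again, which leaves the work register clean for the next
round. -/
theorem orun_hom_swaps (F : (Fin m ⊕ Fin r → Bool) → Fin ℓ → Bool) (t : Fin T)
    (a : Fin T × Fin m → Bool) (b : Fin m → Bool) (b' : Fin r → Bool) (h : Fin ℓ → Bool)
    (y : Fin T × Fin ℓ' → Bool) (z : Fin T × Fin r → Bool) (ha : ∀ o, a (t, o) = false)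
    (hz : ∀ o, z (t, o) = false) :
    orun F ((List.finRange r).map fun b =>
      (OGate.gate (Gate.two (Sum.inl (Sum.inr (Sum.inl (Sum.inr b))))
        (Sum.inr (Sum.inr (Sum.inr (Sum.inr (t, b))))) (by simp) Gate.swapMatrix) :
        OGate (HomWires T m r ℓ ℓ' w w') _ _))
      (orun F ((List.finRange m).map fun b =>
        OGate.gate (Gate.two (Sum.inl (Sum.inr (Sum.inl (Sum.inl b)))) (Sum.inl (Sum.inl (t, b)))
          (by simp) Gate.swapMatrix)) (ket (homPack a (Sum.elim b b') h y z))) =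
      ket (homPack (updSlot t a b) (fun _ => false) h y (updSlot t z b')) := by
  rw [orun_swaps F (fun b => Sum.inl (Sum.inr (Sum.inl (Sum.inl b))))
    (fun b => Sum.inl (Sum.inl (t, b))) (fun _ _ h => by simpa using h)
    (fun _ _ h => by simpa using h) (by simp) _ (List.nodup_finRange m) _
    (homPack (updSlot t a b) (Sum.elim (fun _ => false) b') h y z)]
  · refine orun_swaps F (fun b => Sum.inl (Sum.inr (Sum.inl (Sum.inr b))))
      (fun b => Sum.inr (Sum.inr (Sum.inr (Sum.inr (t, b))))) (fun _ _ h => by simpa using h)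
      (fun _ _ h => by simpa using h) (by simp) _ (List.nodup_finRange r) _ _ ?_ ?_ ?_
    · intro i _
      exact (hz i).symm
    · intro i _
      exact updSlot_self t z b' i
    · rintro ((p | (i | i) | i) | i | p | i | ⟨s, i⟩) hx
      · rfl
      · rfl
      · exact absurd rfl (hx i (List.mem_finRange i)).1
      · rfl
      · rfl
      · rfl
      · rfl
      · refine updSlot_of_ne z b' ?_
        rintro rfl
        exact (hx i (List.mem_finRange i)).2 rfl
  · intro i _
    exact (ha i).symm
  · intro i _
    exact updSlot_self t a b i
  · rintro ((⟨s, i⟩ | (i | i) | i) | i | p | i | p) hx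
    · refine updSlot_of_ne a b ?_
      rintro rfl
      exact (hx i (List.mem_finRange i)).2 rfl
    · exact absurd rfl (hx i (List.mem_finRange i)).1
    all_goals rfl

/-- The wires that are used in a given round. -/
def homSlot : HomWires T m r ℓ ℓ' w w' → Option (Fin T) :=
  Sum.elim (Sum.elim (fun p => some p.1) fun _ => none)
    (Sum.elim (fun _ => none) (Sum.elim (fun p => some p.1) (Sum.elim (fun _ => none)
      fun p => some p.1)))

variable [Finite G]

theorem isSamplingRound_homRound {L : IrrLabels G m} {elt : G → Fin m ⊕ Fin r → Bool}
    {R : ∀ K : Subgroup G, IrrMatrices K} {J : IndexLabels R r}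
    {c : List (Gate (RegWires (Fin T × Fin m) (Fin m ⊕ Fin r) w))}
    {d : List (Gate (RegWires (Fin T × Fin m) (Fin ℓ ⊕ Fin ℓ') w'))}
    {N : Subgroup G} [N.Normal] {f : G →* H}
    (hf : ∀ x x' : G, f x = f x' ↔ ∃ y ∈ N, x' = x * y) (hc : ComputesGroupQFT L elt R J N c)
    {helt : H → Fin ℓ → Bool} {hcls : ∀ K : Subgroup G, ConjClasses (K.map f) → Fin ℓ' → Bool}
    (hcls_inj : ∀ K : Subgroup G, K.Normal → N ≤ K → Function.Injective (hcls K))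
    (hd : ComputesClasses f L helt hcls N d) {F : (Fin m ⊕ Fin r → Bool) → Fin ℓ → Bool}
    (hF : ∀ g, F (elt g) = helt (f g)) (t : Fin T) :
    IsSamplingRound L F (fun i => Sum.inl (Sum.inl i)) homSlot N t
      (homRound (w := w) (w' := w') c d t) := by
  classical
  intro x hx
  obtain ⟨hclean, haddr, hle⟩ := hx
  set a : Fin T × Fin m → Bool := fun p => x (Sum.inl (Sum.inl p)) with ha
  set y : Fin T × Fin ℓ' → Bool := fun p => x (Sum.inr (Sum.inr (Sum.inl p))) with hy
  set z : Fin T × Fin r → Bool := fun p => x (Sum.inr (Sum.inr (Sum.inr (Sum.inr p)))) with hz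
  have ha0 : ∀ b, a (t, b) = false := fun b => hclean _ fun s hs => by
    simp only [homSlot, Sum.elim_inl, Option.some.injEq] at hs; rw [hs]
  have hy0 : ∀ b, y (t, b) = false := fun b => hclean _ fun s hs => by
    simp only [homSlot, Sum.elim_inr, Sum.elim_inl, Option.some.injEq] at hs; rw [hs]
  have hz0 : ∀ b, z (t, b) = false := fun b => hclean _ fun s hs => by
    simp only [homSlot, Sum.elim_inr, Option.some.injEq] at hs; rw [hs]
  have hxeq : x = homPack a (fun _ => false) (fun _ => false) y z := by
    ext ((p | i | i) | i | p | i | p)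
    · rfl
    · exact hclean _ fun s hs => by simp [homSlot] at hs
    · exact hclean _ fun s hs => by simp [homSlot] at hs
    · exact hclean _ fun s hs => by simp [homSlot] at hs
    · rfl
    · exact hclean _ fun s hs => by simp [homSlot] at hs
    · rfl
  set K := L.subgroupAt a with hK
  have hKn : K.Normal := L.subgroupAt_normal a
  have := L.finite_irr K
  have := Fintype.ofFinite (Irr K)
  have := Fintype.ofFinite K
  set φ : K → Fin ℓ' → Bool := fun g => hcls K (imageClass f K g) with hφ
  have hsep : ConjSep (N.subgroupOf K) φ := conjSep_imageClass hf K (hcls_inj K hKn hle)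
  set lab : (R K).Entry → Fin m ⊕ Fin r → Bool := fun s =>
    Sum.elim (L.label K s.1) (J.label K s.1 s.2) with hlab
  have hrun : ∀ g : K, run c (ket (pack a (elt g))) =
      ∑ s : (R K).Entry, (R K).qftEntry s g • ket (pack a (lab s)) := by
    intro g
    rw [hc a haddr hle g]
    ext v
    rw [finsum_eq_sum_of_fintype]
    simp only [Finset.sum_apply, Pi.smul_apply, smul_eq_mul]
    rfl
  -- As for classes, the preimage of the zero label is found by exhibiting it; here it is the
  -- uniform superposition over `K`.
  have hinv : run (inverse c) (ket (pack a fun _ => false)) =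
      ∑ g : K, (Real.sqrt (1 / Nat.card K) : ℂ) • ket (pack a (elt g)) := by
    refine run_inverse_ket ?_
    simp only [hrun, Finset.smul_sum, smul_smul]
    rw [Finset.sum_comm]
    simp only [← Finset.sum_smul, IrrMatrices.sum_qftEntry]
    have hz : 0 < (R K).dim 1 := by rw [(R K).dim_one]; exact one_pos
    rw [Finset.sum_eq_single ⟨1, ⟨0, hz⟩, ⟨0, hz⟩⟩]
    · rw [if_pos rfl, one_smul]
      congr 2
      ext (i | i)
      · exact congrFun (L.label_one K) i
      · exact congrFun (J.label_one K _) i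
    · rintro ⟨μ, i, j⟩ - hne
      rw [if_neg, zero_smul]
      rintro h
      obtain rfl : μ = 1 := h
      refine hne ?_
      congr 2 <;> exact Subsingleton.elim _ _
    · simp
  refine sampling_of_expansion (L := L) (addr := fun i => Sum.inl (Sum.inl i)) (slot := homSlot)
    (N := N) t x K (fun s : (R K).Entry => s.1) ((R K).samplingAmp φ)
    (fun s v => homPack (updSlot t a (L.label K s.1)) (fun _ => false) (fun _ => false)
      (updSlot t y v) (updSlot t z (J.label K s.1 s.2)))
    ?_ ?_ ?_ ?_ ?_ ?_
  · have hstart : orun F (liftCircuit Function.Embedding.inl (inverse c))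
        (ket (homPack (w := w) (w' := w') (ℓ := ℓ) a (fun _ => false) (fun _ => false) y z)) =
        ∑ g : K, (Real.sqrt (1 / Nat.card K) : ℂ) •
          ket (homPack a (elt g) (fun _ => false) y z) :=
      orun_lift_inl_ket F _ _ _ _ _ _ hinv
    have hquery : ∀ (b : Fin m ⊕ Fin r → Bool) (h : Fin ℓ → Bool) (y : Fin T × Fin ℓ' → Bool),
        orun F [OGate.query homQueryWires] (ket (homPack (w := w) (w' := w') a b h y z)) =
          ket (homPack a b (fun o => xor (h o) (F b o)) y z) := by
      intro b h y
      change (OGate.query homQueryWires).apply F (ket _) = _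
      rw [query_apply_ket, queryMap_homQueryWires]
    have hclass : ∀ g : K, orun F (liftCircuit (homClassWires t) d)
        (ket (homPack (w := w) (w' := w') a (elt g) (helt (f g)) y z)) =
          ket (homPack a (elt g) (helt (f g)) (updSlot t y (φ g)) z) := by
      intro g
      rw [orun_liftCircuit_ket F (homClassWires t) d _ (Finset.univ : Finset Unit) (fun _ => 1)
        (fun _ => pack a (Sum.elim (helt (f g)) (φ g)))]
      · simp only [Finset.univ_unique, Finset.sum_singleton, one_smul, extend_homClassWires]
      · rw [homPack_comp_homClassWires]
        simp only [hy0]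
        rw [hd a haddr hle ⟨f g, Subgroup.mem_map_of_mem f g.2⟩]
        simp only [Finset.univ_unique, Finset.sum_singleton, one_smul]
        rfl
    have hqft : ∀ (g : K) (h : Fin ℓ → Bool) (y : Fin T × Fin ℓ' → Bool),
        orun F (liftCircuit Function.Embedding.inl c)
          (ket (homPack (w := w) (w' := w') a (elt g) h y z)) =
        ∑ s : (R K).Entry, (R K).qftEntry s g • ket (homPack a (lab s) h y z) :=
      fun g h y => orun_lift_inl_ket F _ _ _ _ _ _ (hrun g)
    simp only [homRound, orun_append]
    rw [hxeq, hstart]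
    -- `Bool.false_xor` is the first query, which writes the value of `f`; `Bool.xor_self` is the
    -- second, which erases it once its class has been stored.
    simp only [orun_sum_smul, hquery, hF, Bool.false_xor, hclass, Bool.xor_self, hqft, hlab]
    simp only [orun_hom_swaps F t a _ _ _ _ z ha0 hz0, Finset.smul_sum, smul_smul]
    rw [Finset.sum_comm]
    exact Finset.sum_congr rfl fun s _ => (R K).sum_fiberwise_samplingAmp φ s fun v =>
      ket (homPack (updSlot t a (L.label K s.1)) (fun _ => false) (fun _ => false)
        (updSlot t y v) (updSlot t z (J.label K s.1 s.2)))
  · rintro ⟨μ, ij⟩ v ⟨μ', ij'⟩ v' h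
    -- Index labels are injective only for a fixed character, so the characters have to be
    -- identified first.
    have h1 : μ = μ' := by
      refine L.label_injective K hKn (updSlot_injective t a (funext fun p => ?_))
      exact congrFun h (Sum.inl (Sum.inl p))
    subst h1
    have h2 : ij = ij' := by
      refine J.label_injective K μ hKn (updSlot_injective t z (funext fun p => ?_))
      exact congrFun h (Sum.inr (Sum.inr (Sum.inr (Sum.inr p))))
    subst h2
    refine ⟨rfl, updSlot_injective t y (funext fun p => ?_)⟩
    exact congrFun h (Sum.inr (Sum.inr (Sum.inl p)))
  · intro s v u hu
    rw [hxeq]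
    rcases u with (p | i | i) | i | p | i | p
    · exact updSlot_of_ne a _ fun h => hu (congrArg some h)
    · rfl
    · rfl
    · rfl
    · exact updSlot_of_ne y _ fun h => hu (congrArg some h)
    · rfl
    · exact updSlot_of_ne z _ fun h => hu (congrArg some h)
  · intro s v b
    exact updSlot_self t a _ b
  · intro s v h
    exact (R K).le_ker_of_samplingAmp_ne_zero φ hsep h
  · intro hN
    refine (R K).sum_samplingAmp_one_sq_le φ (fun h => hN ?_) hsep
    exact le_antisymm hle (Subgroup.subgroupOf_eq_top.1 h)

end HomRound

/-! ### Costs -/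

section Costs

variable {m r T ℓ w ℓ' w' : ℕ}

theorem length_inverse {W : Type*} (c : List (Gate W)) : (inverse c).length = c.length := by
  simp [inverse]

theorem length_flatMap_finRange {Γ : Type*} (r : Fin T → List Γ) (B : ℕ)
    (h : ∀ t, (r t).length = B) : ((List.finRange T).flatMap r).length = T * B := by
  simp [List.length_flatMap, h]

theorem cost_recursiveAKR (c : List (Gate (RegWires (Fin T × Fin m) (Fin m) w))) :
    cost (AlgWires T m ℓ w) (recursiveAKR ℓ c) =
      T * m + (m + w) + T * ℓ + T * (2 * c.length + 1 + m) := by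
  rw [cost, recursiveAKR, length_flatMap_finRange _ (2 * c.length + 1 + m)]
  · simp
  · intro t
    simp [akrRound, liftCircuit, length_inverse]
    ring

theorem cost_recursiveHom (c : List (Gate (RegWires (Fin T × Fin m) (Fin m ⊕ Fin r) w)))
    (d : List (Gate (RegWires (Fin T × Fin m) (Fin ℓ ⊕ Fin ℓ') w'))) :
    cost (HomWires T m r ℓ ℓ' w w') (recursiveHom c d) =
      T * m + (m + r + w) + (ℓ + (T * ℓ' + (w' + T * r))) +
        T * (2 * c.length + d.length + 2 + m + r) := by
  rw [cost, recursiveHom, length_flatMap_finRange _ (2 * c.length + d.length + 2 + m + r)]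
  · simp
  · intro t
    simp [homRound, liftCircuit, length_inverse]
    ring

end Costs

end HSHP

end

/-! ### Assembly: cost polynomials and success probabilities. -/

theorem mainTheorem7 :
    -- each sample of AKR has `N` in its kernel and is trivial with probability at most `1/2`
    (∀ (G : Type*) [Group G] [Finite G] (N : Subgroup G) [N.Normal] (Λ : Type*)
        (f : ConjClasses G → Λ), HSHP.Hides f (HSHP.subhyp N) →
      (∀ μ : HSHP.Irr G, HSHP.akrProb f μ ≠ 0 → N ≤ μ.ker) ∧
      (N ≠ ⊤ → HSHP.akrProb f 1 ≤ 1 / 2)) ∧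
    -- recursive AKR solves the CC-HSHP efficiently
    (∀ p : Polynomial ℕ, ∃ q : Polynomial ℕ,
      ∀ (G : Type*) [Group G] [Finite G] (k n T : ℕ), n = Nat.log 2 (Nat.card G) + k → T = 4 * n →
      ∀ (m ℓ w : ℕ) (L : HSHP.IrrLabels G m)
        (cls : ∀ K : Subgroup G, ConjClasses K → Fin m → Bool),
        (∀ K : Subgroup G, K.Normal → Function.Injective (cls K)) →
      ∀ c : List (HSHP.Gate (HSHP.RegWires (Fin T × Fin m) (Fin m) w)),
        HSHP.cost (HSHP.RegWires (Fin T × Fin m) (Fin m) w) c ≤ p.eval n → ℓ ≤ p.eval n →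
      HSHP.cost (HSHP.AlgWires T m ℓ w) (HSHP.recursiveAKR ℓ c) ≤ q.eval n ∧
      ∀ (N : Subgroup G) [N.Normal], HSHP.ComputesClassQFT L cls N c →
      ∀ f : ∀ K : Subgroup G, ConjClasses K → Fin ℓ → Bool,
        (∀ K : Subgroup G, K.Normal → N ≤ K →
          HSHP.Hides (f K) (HSHP.subhyp (N.subgroupOf K))) →
      ∀ F : ((Fin T × Fin m) ⊕ Fin m → Bool) → Fin ℓ → Bool,
        (∀ a : Fin T × Fin m → Bool, L.IsAddress a → N ≤ L.subgroupAt a →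
          ∀ C : ConjClasses (L.subgroupAt a), F (Sum.elim a (cls _ C)) = f _ C) →
      1 - (1 / 2 : ℝ) ^ k ≤
        HSHP.successProb L (fun i => Sum.inl (Sum.inl i)) N
          (HSHP.orun F (HSHP.recursiveAKR ℓ c) (HSHP.ket fun _ => false))) ∧
    -- the hidden normal subgroup problem for homomorphic oracles
    (∀ p : Polynomial ℕ, ∃ q : Polynomial ℕ,
      ∀ (G H : Type*) [Group G] [Finite G] [Group H] (k n T : ℕ),
        n = Nat.log 2 (Nat.card G) + k → T = 4 * n →
      ∀ (m r ℓ ℓ' w w' : ℕ) (L : HSHP.IrrLabels G m) (elt : G → Fin m ⊕ Fin r → Bool),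
        Function.Injective elt →
      ∀ (R : ∀ K : Subgroup G, HSHP.IrrMatrices K) (J : HSHP.IndexLabels R r)
        (c : List (HSHP.Gate (HSHP.RegWires (Fin T × Fin m) (Fin m ⊕ Fin r) w)))
        (d : List (HSHP.Gate (HSHP.RegWires (Fin T × Fin m) (Fin ℓ ⊕ Fin ℓ') w'))),
        HSHP.cost (HSHP.RegWires (Fin T × Fin m) (Fin m ⊕ Fin r) w) c ≤ p.eval n →
        HSHP.cost (HSHP.RegWires (Fin T × Fin m) (Fin ℓ ⊕ Fin ℓ') w') d ≤ p.eval n →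
      HSHP.cost (HSHP.HomWires T m r ℓ ℓ' w w') (HSHP.recursiveHom c d) ≤ q.eval n ∧
      ∀ (N : Subgroup G) [N.Normal] (f : G →* H),
        (∀ x x' : G, f x = f x' ↔ ∃ y ∈ N, x' = x * y) →
        HSHP.ComputesGroupQFT L elt R J N c →
      ∀ (helt : H → Fin ℓ → Bool) (hcls : ∀ K : Subgroup G, ConjClasses (K.map f) → Fin ℓ' → Bool),
        Set.InjOn helt (Set.range f) →
        (∀ K : Subgroup G, K.Normal → N ≤ K → Function.Injective (hcls K)) →
        HSHP.ComputesClasses f L helt hcls N d →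
      ∀ F : (Fin m ⊕ Fin r → Bool) → Fin ℓ → Bool, (∀ g, F (elt g) = helt (f g)) →
      1 - (1 / 2 : ℝ) ^ k ≤
        HSHP.successProb L (fun i => Sum.inl (Sum.inl i)) N
          (HSHP.orun F (HSHP.recursiveHom c d) (HSHP.ket fun _ => false))) := by
  refine ⟨fun G _ _ N _ Λ f hf => ⟨fun μ h => HSHP.le_ker_of_akrProb_ne_zero hf h,
    fun hN => HSHP.akrProb_one_le hN hf⟩, fun p => ?_, fun p => ?_⟩
  -- The first `p` pays for the wires of the given circuit; each of the `4n` rounds adds at most `p`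
  -- oracle wires and `3p + 1` gates and queries.
  · refine ⟨p + 4 * Polynomial.X * (4 * p + 1), ?_⟩
    intro G _ _ k n T hn hT m ℓ w L cls _ c hc hℓ
    refine ⟨?_, ?_⟩
    · have hm : m + w ≤ p.eval n ∧ T * m + (m + w) ≤ p.eval n ∧ c.length ≤ p.eval n := by
        simp only [HSHP.cost, Fintype.card_sum, Fintype.card_prod, Fintype.card_fin] at hc
        omega
      have h1 : T * ℓ ≤ T * p.eval n := Nat.mul_le_mul_left T hℓ
      have h2 : T * (2 * c.length + 1 + m) ≤ T * (3 * p.eval n + 1) :=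
        Nat.mul_le_mul_left T (by omega)
      have h3 : (p + 4 * Polynomial.X * (4 * p + 1)).eval n =
          p.eval n + T * p.eval n + T * (3 * p.eval n + 1) := by
        simp [hT]
        ring
      rw [HSHP.cost_recursiveAKR, h3]
      omega
    · intro N _ hqft f hf F hF
      have h := HSHP.one_sub_le_successProb_of_isSamplingRound (slot := HSHP.algSlot)
        (fun _ => rfl) (fun t => HSHP.isSamplingRound_akrRound hqft hf hF t)
      have hb := HSHP.pow_mul_card_div_two_le (G := G) hn
      rw [← hT] at hb
      exact (sub_le_sub_left hb 1).trans h
  -- `3p` covers the wires shared by all rounds. Each round adds at most `2p` wires for the class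
  -- and the matrix indices, and at most `5p + 2` gates and queries; the constants are not tight.
  · refine ⟨3 * p + 4 * Polynomial.X * (7 * p + 2), ?_⟩
    intro G H _ _ _ k n T hn hT m r ℓ ℓ' w w' L elt _ R J c d hc hd
    refine ⟨?_, ?_⟩
    · simp only [HSHP.cost, Fintype.card_sum, Fintype.card_prod, Fintype.card_fin] at hc hd
      have h1 : T * ℓ' ≤ T * p.eval n := Nat.mul_le_mul_left T (by omega)
      have h2 : T * r ≤ T * p.eval n := Nat.mul_le_mul_left T (by omega)
      have h3 : T * (2 * c.length + d.length + 2 + m + r) ≤ T * (5 * p.eval n + 2) :=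
        Nat.mul_le_mul_left T (by omega)
      have h4 : (3 * p + 4 * Polynomial.X * (7 * p + 2)).eval n =
          3 * p.eval n + T * p.eval n + T * p.eval n + T * (5 * p.eval n + 2) := by
        simp [hT]
        ring
      rw [HSHP.cost_recursiveHom, h4]
      omega
    · intro N _ f hf hqft helt hcls _ hinj hd' F hF
      have h := HSHP.one_sub_le_successProb_of_isSamplingRound (slot := HSHP.homSlot)
        (fun _ => rfl) (fun t => HSHP.isSamplingRound_homRound hf hqft hinj hd' hF t)
      have hb := HSHP.pow_mul_card_div_two_le (G := G) hn
      rw [← hT] at hb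
      exact (sub_le_sub_left hb 1).trans h
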